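/- Let $d\ge 1$, let $\mathcal O=\mathbb C\{x_1,\dots,x_d\}$ be the ring of convergent power series, let $P\in\mathcal O\setminus\{0\}$ with $P(0)=0$, let $s\ge 0$ be real, and let $E$ be a complex Banach space with space $\hat{\mathcal O}(E)=E[[x_1,\dots,x_d]]$ of formal power series. For $r>0$ put $D_r^d=\{x\in\mathbb C^d: |x_j|<r \text{ for all } j\}$, let $\mathcal O_b(D_r^d,E)$ be the set of bounded holomorphic maps $D_r^d\to E$, and let $J(g)\in\hat{\mathcal O}(E)$ be the Taylor series at $0$ of $g$. Convergence in $\hat{\mathcal O}(E)$ is understood in the $(x_1,\dots,x_d)$-adic topology. A series $\hat f\in\hat{\mathcal O}(E)$ is called $P$-$s$-Gevrey, written $\hat f\in\hat{\mathcal O}^{P,s}(E)$, if there are $r,C,A>0$ and a sequence $(f_n)_{n\ge0}$ in $\mathcal O_b(D_r^d,E)$ such that $J(f_n)$ converges to $\hat f$, $J(f_n)\equiv\hat f \bmod P^n\hat{\mathcal O}(E)$ for all $n\geq 0$, and $\|f_n(x)\|\le C A^n\, n!^s$ for all $x\in D_r^d$ and $n\ge0$. **Characterization.** A series $\hat f\in\hat{\mathcal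 O}(E)$ belongs to $\hat{\mathcal O}^{P,s}(E)$ if and only if there are $r,C,A>0$ and a sequence $(f_n)_{n\ge0}$ in $\mathcal O_b(D_r^d,E)$ such that $\hat f=\sum_{n=0}^\infty J(f_n)P^n$ and $\|f_n(x)\|\le C A^n\, n!^s$ for all $x\in D_r^d$ and $n\ge0$. Moreover: 1. $\hat{\mathcal O}^{P,s}(E)$ is stable under sums and under the partial derivatives $\partial/\partial x_j$, $1\le j\le d$. If $B$ is a complex Banach algebra, then $\hat{\mathcal O}^{P,s}(B)$ is stable under products. 2. For every integer $N\ge1$, $\hat{\mathcal O}^{P^N,Ns}(E)=\hat{\mathcal O}^{P,s}(E)$. 3. If $Q\in\mathcal O\setminus\{0\}$, $Q(0)=0$ and $Q$ divides $P$ in $\mathcal O$, then $\hat{\mathcal O}^{P,s}(E)\subseteq\hat{\mathcal O}^{Q,s}(E)$. -/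

import Mathlib

namespace GevreyGerm

/-- Formal power series in `d` variables with coefficients in `E`, given by their coefficients.
`MvPowerSeries` is used for complex coefficients, where a ring structure is needed. -/
abbrev FormalSeries (d : ℕ) (E : Type*) : Type _ := (Fin d →₀ ℕ) → E

/-- The monomial `x ^ β = x₁ ^ β₁ ⋯ x_d ^ β_d`. -/
def monomialEval {d : ℕ} (x : Fin d → ℂ) (β : Fin d →₀ ℕ) : ℂ := ∏ i, x i ^ β i

/-- The open polydisk of centre `0` all of whose radii are equal to `r`. -/
def polydisk (d : ℕ) (r : ℝ) : Set (Fin d → ℂ) := {x | ∀ i, ‖x i‖ < r}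

/-- The power series `P` converges in a neighbourhood of the origin. -/
def IsConvergent {d : ℕ} (P : MvPowerSeries (Fin d) ℂ) : Prop :=
  ∃ r : ℝ, 0 < r ∧ ∀ x ∈ polydisk d r,
    Summable fun β : Fin d →₀ ℕ => monomialEval x β * MvPowerSeries.coeff β P

/-- `P` is a nonzero germ of holomorphic function that vanishes at the origin, given by its
convergent power series. -/
structure IsNonzeroVanishingGerm {d : ℕ} (P : MvPowerSeries (Fin d) ℂ) : Prop where
  convergent : IsConvergent P
  ne_zero : P ≠ 0
  vanishes : MvPowerSeries.constantCoeff P = 0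

/-- Divisibility `Q ∣ P` in the ring of convergent power series. -/
def GermDvd {d : ℕ} (Q P : MvPowerSeries (Fin d) ℂ) : Prop :=
  ∃ R : MvPowerSeries (Fin d) ℂ, IsConvergent R ∧ P = Q * R

/-- The product of a scalar series and an `E`-valued series. -/
noncomputable def seriesSMul {d : ℕ} {E : Type*} [AddCommGroup E] [Module ℂ E]
    (P : MvPowerSeries (Fin d) ℂ) (f : FormalSeries d E) : FormalSeries d E :=
  fun β => ∑ p ∈ Finset.HasAntidiagonal.antidiagonal β, MvPowerSeries.coeff p.1 P • f p.2

/-- The product of two series with coefficients in a (not necessarily unital) ring. -/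
noncomputable def seriesMul {d : ℕ} {B : Type*} [NonUnitalRing B]
    (f g : FormalSeries d B) : FormalSeries d B :=
  fun β => ∑ p ∈ Finset.HasAntidiagonal.antidiagonal β, f p.1 * g p.2

/-- The formal partial derivative with respect to the `j`-th variable. -/
noncomputable def seriesPDeriv {d : ℕ} {E : Type*} [AddCommGroup E] (j : Fin d)
    (f : FormalSeries d E) : FormalSeries d E :=
  fun β => (β j + 1) • f (β + Finsupp.single j 1)

/-- Convergence in the `(x₁, …, x_d)`-adic topology: for each `k`, the coefficients of total degree
less than `k` eventually agree with those of the limit. -/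
def AdicTendsto {d : ℕ} {E : Type*} (u : ℕ → FormalSeries d E) (f : FormalSeries d E) : Prop :=
  ∀ k : ℕ, ∃ N : ℕ, ∀ n, N ≤ n → ∀ β : Fin d →₀ ℕ, β.degree < k → u n β = f β

variable {d : ℕ} {E : Type*} [NormedAddCommGroup E] [NormedSpace ℂ E]

/-- `f` is holomorphic and bounded on the polydisk of radius `r`. -/
structure IsBoundedHolomorphic (r : ℝ) (f : (Fin d → ℂ) → E) : Prop where
  holomorphic : DifferentiableOn ℂ f (polydisk d r)
  bounded : ∃ M : ℝ, ∀ x ∈ polydisk d r, ‖f x‖ ≤ M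

/-- `a` is the Taylor series of `f` at the origin: the (unique) power series whose sum is `f` near
the origin. Every function holomorphic near the origin has one. -/
def HasTaylorSeries (f : (Fin d → ℂ) → E) (a : FormalSeries d E) : Prop :=
  ∃ ρ : ℝ, 0 < ρ ∧ ∀ x ∈ polydisk d ρ, HasSum (fun β => monomialEval x β • a β) (f x)

/-- The functions `F n` are bounded and holomorphic on the polydisk of radius `r`, and `a n` is the
Taylor series of `F n` at the origin. -/
structure IsHolomorphicSeq (r : ℝ) (F : ℕ → (Fin d → ℂ) → E) (a : ℕ → FormalSeries d E) :
    Prop where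
  boundedHolomorphic : ∀ n, IsBoundedHolomorphic r (F n)
  taylor : ∀ n, HasTaylorSeries (F n) (a n)

/-- The estimates `‖F n x‖ ≤ C A ^ n (n!) ^ s` on the polydisk of radius `r`. -/
def HasGevreyBounds (s r C A : ℝ) (F : ℕ → (Fin d → ℂ) → E) : Prop :=
  ∀ n : ℕ, ∀ x ∈ polydisk d r, ‖F n x‖ ≤ C * A ^ n * (Nat.factorial n : ℝ) ^ s

/-- The Taylor series `a n` of the members of a `P`-asymptotic sequence for `f`: they converge to
`f`, and `a n ≡ f` modulo `P ^ n` times formal series, for every `n`. -/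
structure IsAsymptoticFor (P : MvPowerSeries (Fin d) ℂ) (f : FormalSeries d E)
    (a : ℕ → FormalSeries d E) : Prop where
  tendsto : AdicTendsto a f
  congr : ∀ n : ℕ, ∃ h : FormalSeries d E, a n - f = seriesSMul (P ^ n) h

/-- `f = ∑ a n * P ^ n` as formal power series. -/
def IsExpansion (P : MvPowerSeries (Fin d) ℂ) (f : FormalSeries d E)
    (a : ℕ → FormalSeries d E) : Prop :=
  AdicTendsto (fun N => ∑ n ∈ Finset.range N, seriesSMul (P ^ n) (a n)) f

/-- The set of `P`-`s`-Gevrey series: those series which have a `P`-asymptotic sequence `F n` of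
bounded holomorphic functions on a common polydisk with `‖F n‖ ≤ C A ^ n (n!) ^ s`. -/
def GevreySeries (P : MvPowerSeries (Fin d) ℂ) (s : ℝ) (E : Type*) [NormedAddCommGroup E]
    [NormedSpace ℂ E] : Set (FormalSeries d E) :=
  {f | ∃ (r C A : ℝ) (F : ℕ → (Fin d → ℂ) → E) (a : ℕ → FormalSeries d E),
    0 < r ∧ 0 < C ∧ 0 < A ∧ IsHolomorphicSeq r F a ∧ IsAsymptoticFor P f a ∧
      HasGevreyBounds s r C A F}

end GevreyGerm

namespace GevreyGerm

open Finset
open scoped NNReal ENNReal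

variable {d : ℕ}

/-! ### Cauchy products of formal series -/

/-! Holomorphic functions are traded for formal series. Cauchy's estimates in one direction and
summation in the other show that sup bounds on a polydisk amount, after shrinking the radius and
enlarging the constants, to bounds on the weighted `ℓ¹` norms of the Taylor series
(`exists_holomorphicSeq_iff`). Membership then means congruences modulo `P ^ n` together with
`HasGevreyGrowth`.

An expansion yields an asymptotic sequence through its partial sums. Conversely, the differences of
an asymptotic sequence have the form `P ^ n * b n`, and `b n` must be bounded on a polydisk that
does not depend on `n`, with only a geometric loss `κ ^ n`. This is the heart of the proof
(`exists_weightedNorm_le_pow_mul`). For a suitable positive weight, `P` has a single lightest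
monomial. In the norm of that weight and a small radius, this monomial dominates the rest of `P`, so
multiplication by `P` is bounded below. The same radius and constant serve for every factor `P`,
hence for every power, and the formal quotients need not be known to converge beforehand.

The stability statements combine formal congruences with comparisons of factorials. Only the
products need the expansion form. -/

theorem sum_antidiagonal_assoc {A M : Type*} [AddCommMonoid A] [HasAntidiagonal A]
    [AddCommMonoid M] (n : A) (F : A → A → A → M) :
    ∑ p ∈ HasAntidiagonal.antidiagonal n, ∑ q ∈ HasAntidiagonal.antidiagonal p.1, F q.1 q.2 p.2 =
      ∑ p ∈ HasAntidiagonal.antidiagonal n, ∑ q ∈ HasAntidiagonal.antidiagonal p.2, F p.1 q.1 q.2 := by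
  rw [Finset.sum_sigma', Finset.sum_sigma']
  apply Finset.sum_nbij' (fun ⟨⟨_i, j⟩, ⟨k, l⟩⟩ ↦ ⟨(k, l + j), (l, j)⟩)
    (fun ⟨⟨i, _j⟩, ⟨k, l⟩⟩ ↦ ⟨(i + k, l), (i, k)⟩)
  · rintro ⟨⟨i, j⟩, ⟨k, l⟩⟩ h
    simp only [mem_sigma, HasAntidiagonal.mem_antidiagonal] at h ⊢
    exact ⟨by rw [← h.1, ← h.2, add_assoc], trivial⟩
  · rintro ⟨⟨i, j⟩, ⟨k, l⟩⟩ h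
    simp only [mem_sigma, HasAntidiagonal.mem_antidiagonal] at h ⊢
    exact ⟨by rw [← h.1, ← h.2, add_assoc], trivial⟩
  · rintro ⟨⟨i, j⟩, ⟨k, l⟩⟩ h
    simp only [mem_sigma, HasAntidiagonal.mem_antidiagonal] at h ⊢
    rw [h.2]
  · rintro ⟨⟨i, j⟩, ⟨k, l⟩⟩ h
    simp only [mem_sigma, HasAntidiagonal.mem_antidiagonal] at h ⊢
    rw [h.2]
  · rintro ⟨⟨i, j⟩, ⟨k, l⟩⟩ _
    rfl

theorem sum_antidiagonal_swap {A M : Type*} [AddCommMonoid A] [HasAntidiagonal A]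
    [AddCommMonoid M] (n : A) (F : A → A → M) :
    ∑ p ∈ HasAntidiagonal.antidiagonal n, F p.2 p.1 =
      ∑ p ∈ HasAntidiagonal.antidiagonal n, F p.1 p.2 := by
  apply Finset.sum_nbij' Prod.swap Prod.swap <;> simp [add_comm]

theorem sum_antidiagonal_left_comm {A M : Type*} [AddCommMonoid A] [HasAntidiagonal A]
    [AddCommMonoid M] (n : A) (F : A → A → A → M) :
    ∑ p ∈ HasAntidiagonal.antidiagonal n, ∑ q ∈ HasAntidiagonal.antidiagonal p.2, F p.1 q.1 q.2 =
      ∑ p ∈ HasAntidiagonal.antidiagonal n, ∑ q ∈ HasAntidiagonal.antidiagonal p.2, F q.1 p.1 q.2 := by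
  rw [← sum_antidiagonal_assoc n F, ← sum_antidiagonal_assoc n fun a b c => F b a c]
  refine Finset.sum_congr rfl fun p _ => ?_
  exact sum_antidiagonal_swap p.1 fun a b => F b a p.2

section Module

variable {E : Type*} [NormedAddCommGroup E] [NormedSpace ℂ E]

theorem seriesSMul_mul (P Q : MvPowerSeries (Fin d) ℂ) (f : FormalSeries d E) :
    seriesSMul (P * Q) f = seriesSMul P (seriesSMul Q f) := by
  funext β
  simp only [seriesSMul, MvPowerSeries.coeff_mul, Finset.sum_smul, Finset.smul_sum, mul_smul]
  exact sum_antidiagonal_assoc β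
    fun a b c => MvPowerSeries.coeff a P • MvPowerSeries.coeff b Q • f c

theorem seriesSMul_add (P : MvPowerSeries (Fin d) ℂ) (f g : FormalSeries d E) :
    seriesSMul P (f + g) = seriesSMul P f + seriesSMul P g := by
  funext β
  simp [seriesSMul, Finset.sum_add_distrib]

theorem seriesSMul_neg (P : MvPowerSeries (Fin d) ℂ) (f : FormalSeries d E) :
    seriesSMul P (-f) = -seriesSMul P f := by
  funext β
  simp [seriesSMul]

theorem seriesSMul_sub (P : MvPowerSeries (Fin d) ℂ) (f g : FormalSeries d E) :
    seriesSMul P (f - g) = seriesSMul P f - seriesSMul P g := by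
  rw [sub_eq_add_neg, seriesSMul_add, seriesSMul_neg, sub_eq_add_neg]

theorem seriesSMul_zero (P : MvPowerSeries (Fin d) ℂ) :
    seriesSMul P (0 : FormalSeries d E) = 0 := by
  funext β
  simp [seriesSMul]

theorem seriesSMul_sum {ι : Type*} (P : MvPowerSeries (Fin d) ℂ) (s : Finset ι)
    (f : ι → FormalSeries d E) :
    seriesSMul P (∑ i ∈ s, f i) = ∑ i ∈ s, seriesSMul P (f i) := by
  classical
  induction s using Finset.induction_on with
  | empty => simp [seriesSMul_zero]
  | insert i s hi ih => rw [Finset.sum_insert hi, Finset.sum_insert hi, seriesSMul_add, ih]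

theorem add_seriesSMul (P Q : MvPowerSeries (Fin d) ℂ) (f : FormalSeries d E) :
    seriesSMul (P + Q) f = seriesSMul P f + seriesSMul Q f := by
  funext β
  simp [seriesSMul, Finset.sum_add_distrib, add_smul]

theorem one_seriesSMul (f : FormalSeries d E) : seriesSMul 1 f = f := by
  classical
  funext β
  rw [seriesSMul, Finset.sum_eq_single (0, β)]
  · simp
  · rintro ⟨p, q⟩ hpq hne
    have hp : p ≠ 0 := by
      rintro rfl
      exact hne (by simpa using hpq)
    simp [MvPowerSeries.coeff_one, hp]
  · simp

theorem seriesSMul_monomial_apply (γ δ : Fin d →₀ ℕ) (c : ℂ) (f : FormalSeries d E) :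
    seriesSMul (MvPowerSeries.monomial γ c) f (γ + δ) = c • f δ := by
  classical
  rw [seriesSMul, Finset.sum_eq_single (γ, δ)]
  · simp
  · rintro ⟨p, q⟩ hpq hne
    have hp : p ≠ γ := by
      rintro rfl
      exact hne (by simpa using hpq)
    simp [MvPowerSeries.coeff_monomial, hp]
  · simp

/-! ### Order of vanishing and adic convergence. -/

theorem coeff_pow_eq_zero_of_degree_lt {P : MvPowerSeries (Fin d) ℂ}
    (hP : MvPowerSeries.constantCoeff P = 0) {n : ℕ} {β : Fin d →₀ ℕ} (hβ : β.degree < n) :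
    MvPowerSeries.coeff β (P ^ n) = 0 := by
  apply MvPowerSeries.coeff_of_lt_order
  refine lt_of_lt_of_le (by exact_mod_cast hβ)
    (MvPowerSeries.le_order_pow_of_constantCoeff_eq_zero n hP)

/-- The series `f` has no coefficients of total degree less than `n`. -/
def VanishesBelow {E : Type*} [Zero E] (n : ℕ) (f : FormalSeries d E) : Prop :=
  ∀ β : Fin d →₀ ℕ, β.degree < n → f β = 0

theorem VanishesBelow.seriesSMul_left {P : MvPowerSeries (Fin d) ℂ} {n : ℕ}
    (hP : ∀ β : Fin d →₀ ℕ, β.degree < n → MvPowerSeries.coeff β P = 0) (f : FormalSeries d E) :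
    VanishesBelow n (seriesSMul P f) := by
  intro β hβ
  refine Finset.sum_eq_zero fun p hp => ?_
  rw [hP p.1 (lt_of_le_of_lt ?_ hβ), zero_smul]
  rw [← HasAntidiagonal.mem_antidiagonal.1 hp, map_add]
  exact Nat.le_add_right _ _

theorem VanishesBelow.seriesSMul_right (P : MvPowerSeries (Fin d) ℂ) {n : ℕ}
    {f : FormalSeries d E} (hf : VanishesBelow n f) : VanishesBelow n (seriesSMul P f) := by
  intro β hβ
  refine Finset.sum_eq_zero fun p hp => ?_
  rw [hf p.2 (lt_of_le_of_lt ?_ hβ), smul_zero]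
  rw [← HasAntidiagonal.mem_antidiagonal.1 hp, map_add]
  exact Nat.le_add_left _ _

theorem vanishesBelow_pow_seriesSMul {P : MvPowerSeries (Fin d) ℂ}
    (hP : MvPowerSeries.constantCoeff P = 0) (n : ℕ) (f : FormalSeries d E) :
    VanishesBelow n (seriesSMul (P ^ n) f) :=
  VanishesBelow.seriesSMul_left (fun _ hβ => coeff_pow_eq_zero_of_degree_lt hP hβ) f

omit [NormedSpace ℂ E] in
theorem adicTendsto_iff {u : ℕ → FormalSeries d E} {f : FormalSeries d E} :
    AdicTendsto u f ↔ ∀ k : ℕ, ∃ N : ℕ, ∀ n, N ≤ n → VanishesBelow k (u n - f) := by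
  simp only [AdicTendsto, VanishesBelow, Pi.sub_apply, sub_eq_zero]

omit [NormedSpace ℂ E] in
theorem AdicTendsto.of_vanishesBelow {u : ℕ → FormalSeries d E} {f : FormalSeries d E}
    (h : ∀ n, VanishesBelow n (u n - f)) : AdicTendsto u f :=
  adicTendsto_iff.2 fun k => ⟨k, fun n hn β hβ => h n β (hβ.trans_le hn)⟩

/-- Congruence modulo the powers of a germ vanishing at `0` implies adic convergence. -/
theorem IsAsymptoticFor.of_congr {P : MvPowerSeries (Fin d) ℂ}
    (hP : MvPowerSeries.constantCoeff P = 0) {f : FormalSeries d E} {a : ℕ → FormalSeries d E}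
    (h : ∀ n, ∃ g : FormalSeries d E, a n - f = seriesSMul (P ^ n) g) : IsAsymptoticFor P f a where
  tendsto := AdicTendsto.of_vanishesBelow fun n => by
    obtain ⟨g, hg⟩ := h n
    rw [hg]
    exact vanishesBelow_pow_seriesSMul hP n g
  congr := h

/-! ### Asymptotic sequences versus expansions. -/

/-- The partial sums of an expansion are congruent to the sum modulo the powers of the germ. -/
theorem IsExpansion.isAsymptoticFor {P : MvPowerSeries (Fin d) ℂ}
    (hP : MvPowerSeries.constantCoeff P = 0) {f : FormalSeries d E} {a : ℕ → FormalSeries d E}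
    (h : IsExpansion P f a) :
    IsAsymptoticFor P f fun n => ∑ k ∈ range n, seriesSMul (P ^ k) (a k) := by
  refine .of_congr hP fun n => ?_
  -- The tail of the expansion from index `n` on, with the factor `P ^ n` removed.
  let T : ℕ → FormalSeries d E := fun m => ∑ k ∈ range m, seriesSMul (P ^ k) (a (n + k))
  have hT : ∀ m m', m ≤ m' → VanishesBelow m (T m' - T m) := by
    intro m m' hm β hβ
    have : T m' - T m = ∑ k ∈ Finset.Ico m m', seriesSMul (P ^ k) (a (n + k)) := by
      rw [Finset.sum_Ico_eq_sub _ hm]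
    rw [this, Finset.sum_apply]
    refine Finset.sum_eq_zero fun k hk => ?_
    exact vanishesBelow_pow_seriesSMul hP k _ β (hβ.trans_le (Finset.mem_Ico.1 hk).1)
  -- The adic limit of `T`: a coefficient of degree `k` is stationary from the partial sum of length
  -- `k + 1` on.
  let g : FormalSeries d E := fun β => T (β.degree + 1) β
  have hg : ∀ m, VanishesBelow m (T m - g) := by
    intro m β hβ
    exact hT _ _ hβ β (Nat.lt_succ_self _)
  refine ⟨-g, ?_⟩
  funext β
  obtain ⟨N, hN⟩ := adicTendsto_iff.1 h (β.degree + 1)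
  -- This index is large enough both for the partial sums to agree with `f` at `β` and for `T` to
  -- agree with `g` there.
  have h1 := hN (n + (N + (β.degree + 1))) (by omega) β (Nat.lt_succ_self _)
  have h2 := VanishesBelow.seriesSMul_right (P ^ n) (hg (N + (β.degree + 1))) β (by omega)
  have h3 : ∑ k ∈ range (n + (N + (β.degree + 1))), seriesSMul (P ^ k) (a k) =
      ∑ k ∈ range n, seriesSMul (P ^ k) (a k) +
        seriesSMul (P ^ n) (T (N + (β.degree + 1))) := by
    rw [Finset.sum_range_add, seriesSMul_sum]
    simp only [pow_add, seriesSMul_mul]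
  simp only [h3] at h1
  rw [seriesSMul_sub] at h2
  rw [seriesSMul_neg]
  simp only [Pi.sub_apply, Pi.add_apply, Pi.neg_apply] at h1 h2 ⊢
  rw [sub_eq_zero] at h1 h2
  rw [← h1, h2]
  abel

/-- Successive differences of an asymptotic sequence give an expansion. -/
theorem IsAsymptoticFor.exists_isExpansion {P : MvPowerSeries (Fin d) ℂ} {f : FormalSeries d E}
    {a : ℕ → FormalSeries d E} (h : IsAsymptoticFor P f a) :
    ∃ b : ℕ → FormalSeries d E, (∀ n, seriesSMul (P ^ n) (b n) = a (n + 1) - a n) ∧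
      IsExpansion P f fun n => if n = 0 then a 1 else b n := by
  choose g hg using h.congr
  have hb : ∀ n, seriesSMul (P ^ n) (seriesSMul P (g (n + 1)) - g n) = a (n + 1) - a n := by
    intro n
    rw [seriesSMul_sub, ← seriesSMul_mul, ← pow_succ, ← hg, ← hg]
    abel
  refine ⟨_, hb, ?_⟩
  -- The sum telescopes. The differences alone would give `a (N + 1) - a 0`; since `P ^ 0 = 1`,
  -- replacing the term `a 1 - a 0` of index `0` by `a 1` restores `a 0`.
  have hs : ∀ N, ∑ n ∈ range (N + 1), seriesSMul (P ^ n)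
      (if n = 0 then a 1 else seriesSMul P (g (n + 1)) - g n) = a (N + 1) := by
    intro N
    induction N with
    | zero => simp [one_seriesSMul]
    | succ N ih =>
      rw [Finset.sum_range_succ, ih, if_neg (Nat.succ_ne_zero N), hb]
      abel
  intro k
  obtain ⟨N, hN⟩ := h.tendsto k
  refine ⟨N + 1, fun n hn β hβ => ?_⟩
  obtain ⟨m, rfl⟩ : ∃ m, n = m + 1 := ⟨n - 1, by omega⟩
  simp only [hs]
  exact hN (m + 1) (by omega) β hβ

/-! ### Partial derivatives -/

omit [NormedSpace ℂ E] in
theorem seriesPDeriv_sub (j : Fin d) (f g : FormalSeries d E) :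
    seriesPDeriv j (f - g) = seriesPDeriv j f - seriesPDeriv j g := by
  funext β
  simp [seriesPDeriv, smul_sub]

/-- The Leibniz rule. -/
theorem seriesPDeriv_seriesSMul (j : Fin d) (P : MvPowerSeries (Fin d) ℂ)
    (f : FormalSeries d E) :
    ∃ P' : MvPowerSeries (Fin d) ℂ,
      seriesPDeriv j (seriesSMul P f) = seriesSMul P' f + seriesSMul P (seriesPDeriv j f) := by
  classical
  refine ⟨(seriesPDeriv j fun β => MvPowerSeries.coeff β P : FormalSeries d ℂ), ?_⟩
  -- Terms with `p.1 j = 0` contribute nothing, and the others are indexed uniquely by lowering `p.1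
  -- j` by one.
  have key : ∀ (β : Fin d →₀ ℕ) (F : (Fin d →₀ ℕ) → (Fin d →₀ ℕ) → E),
      ∑ p ∈ HasAntidiagonal.antidiagonal (β + Finsupp.single j 1 : Fin d →₀ ℕ), p.1 j • F p.1 p.2 =
        ∑ p ∈ HasAntidiagonal.antidiagonal β, (p.1 j + 1) • F (p.1 + Finsupp.single j 1) p.2 := by
    intro β F
    symm
    refine Finset.sum_of_injOn (fun p => (p.1 + Finsupp.single j 1, p.2)) ?_ ?_ ?_ ?_
    · rintro ⟨p, q⟩ _ ⟨p', q'⟩ _ h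
      simpa using h
    · rintro ⟨p, q⟩ h
      have : p + q = β := by simpa using h
      simp [← this, add_right_comm]
    · rintro ⟨p, q⟩ h h'
      have hpq : p + q = β + Finsupp.single j 1 := by simpa using h
      by_contra hne
      have hp : p j ≠ 0 := fun h0 => hne (by simp [h0])
      have hle : Finsupp.single j 1 ≤ p := by
        rw [Finsupp.single_le_iff]; omega
      apply h'
      refine ⟨(p - Finsupp.single j 1, q), ?_, ?_⟩
      · simp only [Finset.mem_coe, HasAntidiagonal.mem_antidiagonal]
        have h2 := tsub_add_cancel_of_le hle
        apply add_right_cancel (b := Finsupp.single j 1)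
        rw [add_right_comm, h2, hpq]
      · simp [tsub_add_cancel_of_le hle]
    · rintro ⟨p, q⟩ _
      simp
  funext β
  simp only [Pi.add_apply]
  have h1 := key β fun p q => MvPowerSeries.coeff p P • f q
  have h2 := key β fun p q => MvPowerSeries.coeff q P • f p
  have hL : seriesPDeriv j (seriesSMul P f) β =
      ∑ p ∈ HasAntidiagonal.antidiagonal (β + Finsupp.single j 1 : Fin d →₀ ℕ), p.1 j • (MvPowerSeries.coeff p.1 P • f p.2) +
      ∑ p ∈ HasAntidiagonal.antidiagonal (β + Finsupp.single j 1 : Fin d →₀ ℕ), p.2 j • (MvPowerSeries.coeff p.1 P • f p.2) := by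
    rw [← Finset.sum_add_distrib]
    simp only [seriesPDeriv, seriesSMul, Finset.smul_sum]
    refine Finset.sum_congr rfl fun p hp => ?_
    rw [← add_smul]
    have := DFunLike.congr_fun (HasAntidiagonal.mem_antidiagonal.1 hp) j
    simp only [Finsupp.add_apply, Finsupp.single_eq_same] at this
    rw [this]
  rw [hL, h1]
  congr 1
  · refine Finset.sum_congr rfl fun p _ => ?_
    rw [← smul_assoc]
    rfl
  -- The two factors are exchanged so that `key`, which lowers the first index, differentiates `f`.
  · rw [sum_antidiagonal_swap _ fun a b => a j • (MvPowerSeries.coeff b P • f a), h2, seriesSMul,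
      ← sum_antidiagonal_swap β fun a b => MvPowerSeries.coeff a P • seriesPDeriv j f b]
    refine Finset.sum_congr rfl fun p _ => ?_
    simp only [seriesPDeriv]
    rw [smul_comm]

/-- A derivative costs exactly one power of `P`, by induction on the Leibniz rule. This is why
asymptotic sequences are shifted by one before being differentiated. -/
theorem exists_seriesPDeriv_pow_seriesSMul (j : Fin d) (P : MvPowerSeries (Fin d) ℂ) (n : ℕ)
    (f : FormalSeries d E) :
    ∃ g : FormalSeries d E, seriesPDeriv j (seriesSMul (P ^ (n + 1)) f) = seriesSMul (P ^ n) g := by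
  induction n with
  | zero => exact ⟨_, by rw [pow_zero, one_seriesSMul]⟩
  | succ n ih =>
    obtain ⟨g, hg⟩ := ih
    obtain ⟨P', hP'⟩ := seriesPDeriv_seriesSMul j P (seriesSMul (P ^ (n + 1)) f)
    refine ⟨seriesSMul P' f + g, ?_⟩
    rw [pow_succ' P (n + 1), seriesSMul_mul, hP', hg, ← seriesSMul_mul, ← seriesSMul_mul,
      seriesSMul_add, ← seriesSMul_mul, mul_comm P', ← pow_succ']

end Module

/-! ### Products -/

section Ring

variable {B : Type*} [NonUnitalNormedRing B]

theorem seriesMul_sum_sum {ι κ : Type*} (s : Finset ι) (t : Finset κ) (f : ι → FormalSeries d B)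
    (g : κ → FormalSeries d B) :
    seriesMul (∑ i ∈ s, f i) (∑ j ∈ t, g j) = ∑ i ∈ s, ∑ j ∈ t, seriesMul (f i) (g j) := by
  funext β
  simp only [seriesMul, Finset.sum_apply, Finset.sum_mul_sum]
  rw [Finset.sum_comm]
  refine Finset.sum_congr rfl fun i _ => ?_
  rw [Finset.sum_comm]

variable [NormedSpace ℂ B] [IsScalarTower ℂ B B] [SMulCommClass ℂ B B]

theorem seriesMul_seriesSMul_seriesSMul (P Q : MvPowerSeries (Fin d) ℂ) (f g : FormalSeries d B) :
    seriesMul (seriesSMul P f) (seriesSMul Q g) = seriesSMul (P * Q) (seriesMul f g) := by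
  have hl : ∀ g : FormalSeries d B,
      seriesMul (seriesSMul P f) g = seriesSMul P (seriesMul f g) := by
    intro g
    funext β
    simp only [seriesSMul, seriesMul, Finset.sum_mul, Finset.smul_sum, smul_mul_assoc]
    exact sum_antidiagonal_assoc β fun a b c => MvPowerSeries.coeff a P • (f b * g c)
  have hr : seriesMul f (seriesSMul Q g) = seriesSMul Q (seriesMul f g) := by
    funext β
    simp only [seriesSMul, seriesMul, Finset.mul_sum, Finset.smul_sum, mul_smul_comm]
    exact sum_antidiagonal_left_comm β fun a b c => MvPowerSeries.coeff b Q • (f a * g c)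
  rw [hl, hr, seriesSMul_mul]

/-- The Cauchy product of two expansions is an expansion of the product. -/
theorem IsExpansion.seriesMul {P : MvPowerSeries (Fin d) ℂ}
    (hP : MvPowerSeries.constantCoeff P = 0) {f g : FormalSeries d B}
    {a b : ℕ → FormalSeries d B} (hf : IsExpansion P f a) (hg : IsExpansion P g b) :
    IsExpansion P (seriesMul f g)
      fun n => ∑ p ∈ HasAntidiagonal.antidiagonal n, GevreyGerm.seriesMul (a p.1) (b p.2) := by
  intro k
  obtain ⟨N₁, h₁⟩ := hf k
  obtain ⟨N₂, h₂⟩ := hg k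
  refine ⟨N₁ + N₂ + k, fun n hn β hβ => ?_⟩
  have hfg : GevreyGerm.seriesMul f g β =
      GevreyGerm.seriesMul (∑ i ∈ range n, seriesSMul (P ^ i) (a i))
        (∑ j ∈ range n, seriesSMul (P ^ j) (b j)) β := by
    refine Finset.sum_congr rfl fun p hp => ?_
    have hd : p.1.degree + p.2.degree = β.degree := by
      rw [← map_add, HasAntidiagonal.mem_antidiagonal.1 hp]
    exact congrArg₂ (· * ·) (h₁ n (by omega) p.1 (by omega)).symm
      (h₂ n (by omega) p.2 (by omega)).symm
  let G : ℕ × ℕ → B := fun p =>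
    seriesSMul (P ^ (p.1 + p.2)) (GevreyGerm.seriesMul (a p.1) (b p.2)) β
  have hR : GevreyGerm.seriesMul (∑ i ∈ range n, seriesSMul (P ^ i) (a i))
      (∑ j ∈ range n, seriesSMul (P ^ j) (b j)) β = ∑ p ∈ range n ×ˢ range n, G p := by
    rw [seriesMul_sum_sum, Finset.sum_apply, Finset.sum_product]
    simp only [Finset.sum_apply, seriesMul_seriesSMul_seriesSMul, ← pow_add, G]
  have hL : (∑ m ∈ range n, seriesSMul (P ^ m)
      (∑ p ∈ HasAntidiagonal.antidiagonal m, GevreyGerm.seriesMul (a p.1) (b p.2))) β =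
      ∑ p ∈ range n ×ˢ range n with p.1 + p.2 < n, G p := by
    rw [Finset.sum_apply, ← Finset.sum_fiberwise_of_maps_to (t := range n)
      (g := fun p : ℕ × ℕ => p.1 + p.2) (by simp)]
    refine Finset.sum_congr rfl fun m hm => ?_
    rw [seriesSMul_sum, Finset.sum_apply]
    refine Finset.sum_congr ?_ ?_
    · ext p
      simp only [HasAntidiagonal.mem_antidiagonal, Finset.mem_filter, Finset.mem_product, Finset.mem_range]
        at hm ⊢
      omega
    · intro p hp
      simp only [Finset.mem_filter] at hp
      simp only [G, hp.2]
  rw [hfg, hR]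
  refine hL.trans ?_
  -- The Cauchy product sums over the triangle `i + j < n`, the product of partial sums over the
  -- whole square. The terms in between carry `P ^ (i + j)` with `i + j ≥ n ≥ k`, so they vanish in
  -- degrees below `k`.
  refine Finset.sum_subset (Finset.filter_subset _ _) fun p hp hp' => ?_
  have : n ≤ p.1 + p.2 := by
    by_contra hlt
    exact hp' (Finset.mem_filter.2 ⟨hp, by omega⟩)
  exact vanishesBelow_pow_seriesSMul hP _ _ β (by omega)

end Ring

/-! ### Weighted norms of formal series -/

/-- The weighted norm `∑ ‖a β‖ t ^ ⟨w, β⟩` of a formal series. -/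
noncomputable def weightedNorm {E : Type*} [NormedAddCommGroup E] (w : Fin d → ℕ) (t : ℝ≥0)
    (a : FormalSeries d E) : ℝ≥0∞ :=
  ∑' β, ‖a β‖ₑ * (t : ℝ≥0∞) ^ Finsupp.weight w β

/-- The family of coefficients of a scalar power series. -/
def coeffs (P : MvPowerSeries (Fin d) ℂ) : FormalSeries d ℂ := fun β => MvPowerSeries.coeff β P

section

variable {E : Type*} [NormedAddCommGroup E] (w : Fin d → ℕ) (t : ℝ≥0)

theorem weightedNorm_le_of_enorm_le {F : Type*} [NormedAddCommGroup F] {a : FormalSeries d E}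
    {b : FormalSeries d F} (h : ∀ β, ‖a β‖ₑ ≤ ‖b β‖ₑ) : weightedNorm w t a ≤ weightedNorm w t b :=
  ENNReal.tsum_le_tsum fun β => mul_le_mul_left (h β) _

theorem weightedNorm_zero : weightedNorm w t (0 : FormalSeries d E) = 0 := by
  simp [weightedNorm]

theorem weightedNorm_add_le (a b : FormalSeries d E) :
    weightedNorm w t (a + b) ≤ weightedNorm w t a + weightedNorm w t b := by
  rw [weightedNorm, weightedNorm, weightedNorm, ← ENNReal.tsum_add]
  refine ENNReal.tsum_le_tsum fun β => ?_
  rw [← add_mul]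
  gcongr
  exact enorm_add_le _ _

theorem weightedNorm_sub_le (a b : FormalSeries d E) :
    weightedNorm w t (a - b) ≤ weightedNorm w t a + weightedNorm w t b := by
  rw [sub_eq_add_neg]
  refine (weightedNorm_add_le w t a (-b)).trans ?_
  gcongr
  exact weightedNorm_le_of_enorm_le w t fun β => by simp

theorem weightedNorm_sum_le {ι : Type*} (s : Finset ι) (a : ι → FormalSeries d E) :
    weightedNorm w t (∑ i ∈ s, a i) ≤ ∑ i ∈ s, weightedNorm w t (a i) := by
  classical
  induction s using Finset.induction_on with
  | empty => simp [weightedNorm_zero]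
  | insert i s hi ih =>
    rw [Finset.sum_insert hi, Finset.sum_insert hi]
    exact (weightedNorm_add_le w t _ _).trans (by gcongr)

variable {w t} in
theorem weightedNorm_mono {t' : ℝ≥0} (h : t ≤ t') (a : FormalSeries d E) :
    weightedNorm w t a ≤ weightedNorm w t' a :=
  ENNReal.tsum_le_tsum fun β => by gcongr

/-- Weights are additive on exponents, so this is submultiplicativity of the `ℓ¹` norm under
convolution. Only a bound on `c` is required, so that products of series and multiplication by
scalar series are both covered. -/
theorem weightedNorm_cauchyProduct_le {F G : Type*} [NormedAddCommGroup F] [NormedAddCommGroup G]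
    {a : FormalSeries d E} {b : FormalSeries d F} {c : FormalSeries d G}
    (h : ∀ β, ‖c β‖ₑ ≤ ∑ p ∈ HasAntidiagonal.antidiagonal β, ‖a p.1‖ₑ * ‖b p.2‖ₑ) :
    weightedNorm w t c ≤ weightedNorm w t a * weightedNorm w t b := by
  calc weightedNorm w t c
      ≤ ∑' β : Fin d →₀ ℕ, ∑' p : HasAntidiagonal.antidiagonal β,
          (‖a p.1.1‖ₑ * (t : ℝ≥0∞) ^ Finsupp.weight w p.1.1) *
            (‖b p.1.2‖ₑ * (t : ℝ≥0∞) ^ Finsupp.weight w p.1.2) := by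
        refine ENNReal.tsum_le_tsum fun β => (mul_le_mul_left (h β) _).trans (le_of_eq ?_)
        rw [Finset.tsum_subtype (HasAntidiagonal.antidiagonal β) fun p =>
          (‖a p.1‖ₑ * (t : ℝ≥0∞) ^ Finsupp.weight w p.1) *
            (‖b p.2‖ₑ * (t : ℝ≥0∞) ^ Finsupp.weight w p.2), Finset.sum_mul]
        refine Finset.sum_congr rfl fun p hp => ?_
        rw [← HasAntidiagonal.mem_antidiagonal.1 hp, map_add, pow_add]
        ring
    _ = ∑' p : (Fin d →₀ ℕ) × (Fin d →₀ ℕ),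
          (‖a p.1‖ₑ * (t : ℝ≥0∞) ^ Finsupp.weight w p.1) *
            (‖b p.2‖ₑ * (t : ℝ≥0∞) ^ Finsupp.weight w p.2) := by
        rw [← HasAntidiagonal.sigmaAntidiagonalEquivProd.tsum_eq, ENNReal.tsum_sigma']
        rfl
    _ = weightedNorm w t a * weightedNorm w t b := by
        rw [ENNReal.tsum_prod']
        simp only [ENNReal.tsum_mul_left, ENNReal.tsum_mul_right]
        rfl

theorem weightedNorm_seriesMul_le {B : Type*} [NonUnitalNormedRing B] (f g : FormalSeries d B) :
    weightedNorm w t (seriesMul f g) ≤ weightedNorm w t f * weightedNorm w t g :=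
  weightedNorm_cauchyProduct_le w t fun _ => (enorm_sum_le _ _).trans <|
    Finset.sum_le_sum fun _ _ => by
      simpa only [enorm_eq_nnnorm, ← ENNReal.coe_mul, ENNReal.coe_le_coe] using nnnorm_mul_le _ _

theorem weightedNorm_seriesSMul_le [NormedSpace ℂ E] (P : MvPowerSeries (Fin d) ℂ)
    (f : FormalSeries d E) :
    weightedNorm w t (seriesSMul P f) ≤ weightedNorm w t (coeffs P) * weightedNorm w t f :=
  weightedNorm_cauchyProduct_le w t fun _ => (enorm_sum_le _ _).trans <|
    Finset.sum_le_sum fun _ _ => (enorm_smul _ _).le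

theorem weightedNorm_pow_seriesSMul_le [NormedSpace ℂ E] (P : MvPowerSeries (Fin d) ℂ) (n : ℕ)
    (f : FormalSeries d E) :
    weightedNorm w t (seriesSMul (P ^ n) f) ≤ weightedNorm w t (coeffs P) ^ n *
      weightedNorm w t f := by
  induction n with
  | zero => simp [one_seriesSMul]
  | succ n ih =>
    rw [pow_succ', seriesSMul_mul, pow_succ', mul_assoc]
    exact (weightedNorm_seriesSMul_le w t _ _).trans (by gcongr)

variable {w t}

/-- For `t ≤ 1` a larger exponent gives a smaller term. With the next lemma this allows passing to
an auxiliary weight for the division and back to ordinary polydisks. -/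
theorem weightedNorm_le_weightedNorm_one (hw : ∀ i, 1 ≤ w i) (ht : t ≤ 1) (a : FormalSeries d E) :
    weightedNorm w t a ≤ weightedNorm 1 t a := by
  refine ENNReal.tsum_le_tsum fun β => ?_
  refine mul_le_mul_right ?_ _
  refine pow_le_pow_right_of_le_one' (by exact_mod_cast ht) ?_
  simp only [Finsupp.weight_eq_sum]
  gcongr with i
  exact hw i

theorem weightedNorm_one_pow_le {m : ℕ} (hw : ∀ i, w i ≤ m) (ht : t ≤ 1) (a : FormalSeries d E) :
    weightedNorm 1 (t ^ m) a ≤ weightedNorm w t a := by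
  refine ENNReal.tsum_le_tsum fun β => ?_
  refine mul_le_mul_right ?_ _
  rw [ENNReal.coe_pow, ← pow_mul]
  refine pow_le_pow_right_of_le_one' (by exact_mod_cast ht) ?_
  simp only [Finsupp.weight_eq_sum, Finset.mul_sum]
  refine Finset.sum_le_sum fun i _ => ?_
  simpa [mul_comm] using Nat.mul_le_mul_left (β i) (hw i)

end

/-! ### Weights that isolate a monomial -/

/-- For a suitable positive weight, the monomials of degree `k` are determined by their weights
and dominate those of larger degree. -/
theorem exists_separating_weight (d k : ℕ) : ∃ w : Fin d → ℕ, (∀ i, 1 ≤ w i) ∧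
    ∀ β γ : Fin d →₀ ℕ, γ.degree = k → Finsupp.weight w β ≤ Finsupp.weight w γ →
      β.degree ≤ k ∧ (Finsupp.weight w β = Finsupp.weight w γ → β = γ) := by
  -- In degree at most `k` all exponents are at most `k`, so `μ` reads them as digits in base `k +
  -- 1` and is injective. The number `b` exceeds all these values, so the weight `b * degree + μ`
  -- compares degrees first and uses `μ` to break ties.
  let μ : (Fin d →₀ ℕ) → ℕ := fun β => ∑ i, β i * (k + 1) ^ (i : ℕ)
  let b : ℕ := (k + 1) ^ d * (k + 1)
  have hb : 1 ≤ b := Nat.succ_le_of_lt (by positivity)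
  have hw : ∀ β : Fin d →₀ ℕ,
      Finsupp.weight (fun i : Fin d => b + (k + 1) ^ (i : ℕ)) β = b * β.degree + μ β := by
    intro β
    simp only [Finsupp.weight_eq_sum, Finsupp.degree_eq_sum, smul_eq_mul, mul_add,
      Finset.sum_add_distrib, μ, Finset.sum_mul, mul_comm b]
  have hμ : ∀ β : Fin d →₀ ℕ, β.degree ≤ k → μ β < b := by
    intro β hβ
    calc μ β ≤ ∑ i, β i * (k + 1) ^ d := by
          refine Finset.sum_le_sum fun i _ => Nat.mul_le_mul_left _ ?_
          exact Nat.pow_le_pow_right (Nat.succ_pos k) i.2.le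
      _ = (k + 1) ^ d * β.degree := by rw [← Finset.sum_mul, Finsupp.degree_eq_sum, mul_comm]
      _ < b := Nat.mul_lt_mul_of_pos_left (by omega) (by positivity)
  have hinj : ∀ β γ : Fin d →₀ ℕ, β.degree ≤ k → γ.degree ≤ k → μ β = μ γ → β = γ := by
    intro β γ hβ hγ h
    have hlt : ∀ β : Fin d →₀ ℕ, β.degree ≤ k → ∀ i, β i < k + 1 := fun β hβ i =>
      Nat.lt_succ_of_le ((Finsupp.le_degree i β).trans hβ)
    have := finFunctionFinEquiv.injective (a₁ := fun i => (⟨β i, hlt β hβ i⟩ : Fin (k + 1)))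
      (a₂ := fun i => ⟨γ i, hlt γ hγ i⟩) (Fin.ext h)
    ext i
    exact congrArg Fin.val (congrFun this i)
  refine ⟨fun i => b + (k + 1) ^ (i : ℕ), fun i => hb.trans (Nat.le_add_right _ _),
    fun β γ hγ hle => ?_⟩
  rw [hw, hw, hγ] at hle ⊢
  have hγμ := hμ γ hγ.le
  have hβ : β.degree ≤ k := by
    by_contra hlt
    have : b * (k + 1) ≤ b * β.degree := Nat.mul_le_mul_left b (by omega)
    rw [mul_add] at this
    omega
  refine ⟨hβ, fun h => ?_⟩
  have hβμ := hμ β hβ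
  have hdeg : β.degree = k := by
    by_contra hne
    have : b * (β.degree + 1) ≤ b * k := Nat.mul_le_mul_left b (by omega)
    rw [mul_add] at this
    omega
  rw [hdeg] at h
  exact hinj β γ hβ hγ.le (by omega)

/-- A nonzero power series has a vertex: for a suitable positive weight, one of its monomials has
weight less than all the others. -/
theorem exists_weight_vertex {P : MvPowerSeries (Fin d) ℂ} (hP : P ≠ 0) :
    ∃ (w : Fin d → ℕ) (γ : Fin d →₀ ℕ), (∀ i, 1 ≤ w i) ∧ MvPowerSeries.coeff γ P ≠ 0 ∧
      ∀ β, MvPowerSeries.coeff β P ≠ 0 → β ≠ γ → Finsupp.weight w γ < Finsupp.weight w β := by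
  have hne : {β : Fin d →₀ ℕ | MvPowerSeries.coeff β P ≠ 0}.Nonempty := by
    by_contra h
    refine hP (MvPowerSeries.ext fun β => ?_)
    by_contra hβ
    exact h ⟨β, by simpa using hβ⟩
  obtain ⟨β₀, hβ₀, hmin⟩ := exists_minimalFor_of_wellFoundedLT
    (fun β => MvPowerSeries.coeff β P ≠ 0) (fun β : Fin d →₀ ℕ => β.degree) hne
  obtain ⟨w, hw, hsep⟩ := exists_separating_weight d β₀.degree
  obtain ⟨γ, hγ, hγmin⟩ := exists_minimalFor_of_wellFoundedLT
    (fun β => MvPowerSeries.coeff β P ≠ 0) (fun β : Fin d →₀ ℕ => Finsupp.weight w β) hne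
  have hle : ∀ β, MvPowerSeries.coeff β P ≠ 0 → Finsupp.weight w γ ≤ Finsupp.weight w β := by
    intro β hβ
    by_contra hlt
    exact hlt (hγmin hβ (le_of_not_ge hlt))
  -- The weight separates only against exponents of degree `β₀.degree`; minimality of `β₀` in degree
  -- and of `γ` in weight puts `γ` in that degree.
  have hdeg : γ.degree = β₀.degree := by
    refine le_antisymm (hsep γ β₀ rfl (hle β₀ hβ₀)).1 ?_
    by_contra hlt
    exact hlt (hmin hγ (le_of_not_ge hlt))
  refine ⟨w, γ, hw, hγ, fun β hβ hβγ => lt_of_le_of_ne (hle β hβ) fun h => hβγ ?_⟩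
  exact (hsep β γ hdeg h.ge).2 h.symm

section Division

/-! ### Division by a germ -/

variable {E : Type*} [NormedAddCommGroup E] [NormedSpace ℂ E]

/-- If a monomial `c x ^ γ` dominates the rest `R` of a series, then multiplication by this series
is bounded below. No convergence of `h` is needed. -/
theorem weightedNorm_le_of_dominant {w : Fin d → ℕ} (hw : ∀ i, 1 ≤ w i) {t : ℝ≥0}
    {γ : Fin d →₀ ℕ} {c : ℂ} {R : MvPowerSeries (Fin d) ℂ}
    (hR : ∀ β, MvPowerSeries.coeff β R ≠ 0 → Finsupp.weight w γ < Finsupp.weight w β)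
    (hRn : 2 * weightedNorm w t (coeffs R) ≤ ‖c‖ₑ * (t : ℝ≥0∞) ^ Finsupp.weight w γ)
    (h : FormalSeries d E) :
    ‖c‖ₑ * (t : ℝ≥0∞) ^ Finsupp.weight w γ * weightedNorm w t h ≤
      2 * weightedNorm w t (seriesSMul (MvPowerSeries.monomial γ c + R) h) := by
  classical
  set f := seriesSMul (MvPowerSeries.monomial γ c + R) h with hf
  set m := Finsupp.weight w γ
  -- Truncation by weight makes the norm finite, since positive weights leave finitely many
  -- exponents below `K`. Finiteness is what permits the cancellation ending `hT`.
  let T : ℕ → FormalSeries d E := fun K δ => if Finsupp.weight w δ ≤ K then h δ else 0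
  have hTfin : ∀ K, weightedNorm w t (T K) ≠ ⊤ := by
    intro K
    have hs : (Function.support fun β => ‖T K β‖ₑ * (t : ℝ≥0∞) ^ Finsupp.weight w β).Finite := by
      refine (Finsupp.finite_of_nat_weight_le w (fun i => by have := hw i; omega) K).subset ?_
      intro β hβ
      by_contra hlt
      exact hβ (by simp [T, show ¬ Finsupp.weight w β ≤ K from hlt])
    rw [weightedNorm, tsum_eq_sum (s := hs.toFinset) (by
      intro β hβ
      by_contra hne
      exact hβ (hs.mem_toFinset.2 hne))]
    refine ENNReal.sum_ne_top.2 fun β _ => ENNReal.mul_ne_top enorm_ne_top ?_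
    exact ENNReal.pow_ne_top ENNReal.coe_ne_top
  have hT : ∀ K, ‖c‖ₑ * (t : ℝ≥0∞) ^ m * weightedNorm w t (T K) ≤ 2 * weightedNorm w t f := by
    intro K
    have hpt : ∀ δ, ‖c‖ₑ * ‖T K δ‖ₑ ≤ ‖f (γ + δ)‖ₑ + ‖seriesSMul R (T K) (γ + δ)‖ₑ := by
      intro δ
      by_cases hδ : Finsupp.weight w δ ≤ K
      -- Every monomial of `R` is heavier than `γ`, so this coefficient involves `h` only at weights
      -- below that of `δ`, where truncation changes nothing.
      · have hRT : seriesSMul R (T K) (γ + δ) = seriesSMul R h (γ + δ) := by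
          refine Finset.sum_congr rfl fun p hp => ?_
          by_cases h0 : MvPowerSeries.coeff p.1 R = 0
          · simp [h0]
          · have h1 := hR _ h0
            have h2 := congrArg (Finsupp.weight w) (HasAntidiagonal.mem_antidiagonal.1 hp)
            rw [map_add, map_add] at h2
            have h3 : Finsupp.weight w p.2 ≤ K := by omega
            simp [T, h3]
        have hc : c • T K δ = f (γ + δ) - seriesSMul R (T K) (γ + δ) := by
          rw [hRT, hf, add_seriesSMul, Pi.add_apply, seriesSMul_monomial_apply]
          simp [T, hδ]
        rw [← enorm_smul, hc]
        exact enorm_sub_le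
      · simp [T, hδ]
    have hshift : ∀ g : FormalSeries d E,
        ∑' δ, ‖g (γ + δ)‖ₑ * (t : ℝ≥0∞) ^ Finsupp.weight w (γ + δ) ≤ weightedNorm w t g :=
      fun g => ENNReal.tsum_comp_le_tsum_of_injective (add_right_injective γ)
        fun β => ‖g β‖ₑ * (t : ℝ≥0∞) ^ Finsupp.weight w β
    have hmain : ‖c‖ₑ * (t : ℝ≥0∞) ^ m * weightedNorm w t (T K) ≤
        weightedNorm w t f + weightedNorm w t (coeffs R) * weightedNorm w t (T K) := by
      refine le_trans ?_ (add_le_add (hshift f)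
        ((hshift _).trans (weightedNorm_seriesSMul_le w t R (T K))))
      rw [← ENNReal.tsum_add, weightedNorm, ← ENNReal.tsum_mul_left]
      refine ENNReal.tsum_le_tsum fun δ => ?_
      rw [← add_mul, map_add, pow_add]
      calc ‖c‖ₑ * (t : ℝ≥0∞) ^ m * (‖T K δ‖ₑ * (t : ℝ≥0∞) ^ Finsupp.weight w δ)
          = ‖c‖ₑ * ‖T K δ‖ₑ * ((t : ℝ≥0∞) ^ m * (t : ℝ≥0∞) ^ Finsupp.weight w δ) := by ring
        _ ≤ _ := mul_le_mul_left (hpt δ) _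
    set X := ‖c‖ₑ * (t : ℝ≥0∞) ^ m * weightedNorm w t (T K) with hX
    have hXfin : X ≠ ⊤ := ENNReal.mul_ne_top (ENNReal.mul_ne_top enorm_ne_top
      (ENNReal.pow_ne_top ENNReal.coe_ne_top)) (hTfin K)
    -- By `hRn`, the contribution of `R` is at most half of `X` and is absorbed.
    have h2 : X + X ≤ 2 * weightedNorm w t f + X := by
      calc X + X = 2 * X := (two_mul X).symm
        _ ≤ 2 * (weightedNorm w t f + weightedNorm w t (coeffs R) * weightedNorm w t (T K)) := by
            gcongr
        _ = 2 * weightedNorm w t f +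
              2 * weightedNorm w t (coeffs R) * weightedNorm w t (T K) := by ring
        _ ≤ 2 * weightedNorm w t f + X := by
            rw [hX]
            gcongr
    exact (ENNReal.add_le_add_iff_right hXfin).1 h2
  -- Each finite partial sum of the norm of `h` is seen by a truncation, and the bound does not
  -- depend on `K`.
  rw [weightedNorm, ENNReal.tsum_eq_iSup_sum, ENNReal.mul_iSup]
  refine iSup_le fun s => le_trans ?_ (hT (s.sup (Finsupp.weight w)))
  gcongr
  refine le_trans (le_of_eq ?_) (ENNReal.sum_le_tsum s)
  refine Finset.sum_congr rfl fun β hβ => ?_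
  simp [T, Finset.le_sup (f := Finsupp.weight w) hβ]

/-- Multiplication by a nonzero convergent series is bounded below for suitable weighted norms of
arbitrarily small radius. -/
theorem exists_weightedNorm_le_mul {P : MvPowerSeries (Fin d) ℂ} (hP : P ≠ 0) {ρ : ℝ≥0}
    (hρ : 0 < ρ) (hPρ : weightedNorm 1 ρ (coeffs P) ≠ ⊤) (r : ℝ≥0) (hr : 0 < r) :
    ∃ (w : Fin d → ℕ) (t κ : ℝ≥0), (∀ i, 1 ≤ w i) ∧ 0 < t ∧ t ≤ r ∧
      ∀ h : FormalSeries d E, weightedNorm w t h ≤ κ * weightedNorm w t (seriesSMul P h) := by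
  classical
  obtain ⟨w, γ, hw, hγ, hmin⟩ := exists_weight_vertex hP
  set c := MvPowerSeries.coeff γ P with hc
  set R := P - MvPowerSeries.monomial γ c with hRdef
  have hPR : MvPowerSeries.monomial γ c + R = P := by rw [hRdef]; abel
  have hRc : ∀ β, MvPowerSeries.coeff β R = if β = γ then 0 else MvPowerSeries.coeff β P := by
    intro β
    rw [hRdef, map_sub, MvPowerSeries.coeff_monomial]
    split_ifs with h
    · rw [h, hc, sub_self]
    · rw [sub_zero]
  have hR : ∀ β, MvPowerSeries.coeff β R ≠ 0 → Finsupp.weight w γ < Finsupp.weight w β := by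
    intro β hβ
    rw [hRc] at hβ
    split_ifs at hβ with h
    · exact absurd rfl hβ
    · exact hmin β hβ h
  set m := Finsupp.weight w γ with hm
  obtain ⟨s, hs0, hs1, hsr, hsρ⟩ : ∃ s : ℝ≥0, 0 < s ∧ s ≤ 1 ∧ s ≤ r ∧ s ≤ ρ :=
    ⟨min 1 (min r ρ), by positivity, min_le_left _ _, (min_le_right _ _).trans (min_le_left _ _),
      (min_le_right _ _).trans (min_le_right _ _)⟩
  have hN : weightedNorm w s (coeffs R) ≠ ⊤ := by
    refine ne_top_of_le_ne_top hPρ ?_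
    refine le_trans ?_ ((weightedNorm_le_weightedNorm_one hw hs1 _).trans (weightedNorm_mono hsρ _))
    refine weightedNorm_le_of_enorm_le w s fun β => ?_
    rw [coeffs, coeffs, hRc]
    split_ifs <;> simp
  lift weightedNorm w s (coeffs R) to ℝ≥0 using hN with N hNeq
  have hc0 : 0 < ‖c‖₊ := nnnorm_pos.2 hγ
  -- Shrinking the radius from `s` to `q * s` scales the monomial by `q ^ m` and the rest by at most
  -- `q ^ (m + 1)`; the extra factor `q` is chosen to give dominance. The `+ 1` keeps the
  -- denominator nonzero.
  let q : ℝ≥0 := min 1 (‖c‖₊ * s ^ m / (2 * (N + 1)))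
  have hq0 : 0 < q := by positivity
  have hq1 : q ≤ 1 := min_le_left _ _
  have hqN : 2 * (q * N) ≤ ‖c‖₊ * s ^ m := by
    have : q ≤ ‖c‖₊ * s ^ m / (2 * (N + 1)) := min_le_right _ _
    rw [le_div_iff₀ (by positivity)] at this
    refine le_trans ?_ this
    calc 2 * (q * N) = q * (2 * N) := by ring
      _ ≤ q * (2 * (N + 1)) := by gcongr; exact le_self_add
  have hRn : 2 * weightedNorm w (q * s) (coeffs R) ≤ ‖c‖ₑ * ((q * s : ℝ≥0) : ℝ≥0∞) ^ m := by
    have h1 : weightedNorm w (q * s) (coeffs R) ≤ (q : ℝ≥0∞) ^ (m + 1) * N := by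
      rw [hNeq, weightedNorm, weightedNorm, ← ENNReal.tsum_mul_left]
      refine ENNReal.tsum_le_tsum fun β => ?_
      by_cases hβ : MvPowerSeries.coeff β R = 0
      · simp [coeffs, hβ]
      · have h2 : (q : ℝ≥0∞) ^ Finsupp.weight w β ≤ (q : ℝ≥0∞) ^ (m + 1) :=
          pow_le_pow_right_of_le_one' (by exact_mod_cast hq1) (hR β hβ)
        rw [ENNReal.coe_mul, mul_pow, mul_left_comm]
        gcongr
    calc 2 * weightedNorm w (q * s) (coeffs R) ≤ 2 * ((q : ℝ≥0∞) ^ (m + 1) * N) := by gcongr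
      _ = ((q ^ m * (2 * (q * N)) : ℝ≥0) : ℝ≥0∞) := by push_cast; ring
      _ ≤ ((q ^ m * (‖c‖₊ * s ^ m) : ℝ≥0) : ℝ≥0∞) := by gcongr
      _ = ‖c‖ₑ * ((q * s : ℝ≥0) : ℝ≥0∞) ^ m := by
        rw [enorm_eq_nnnorm]; push_cast; ring
  refine ⟨w, q * s, 2 / (‖c‖₊ * (q * s) ^ m), hw, by positivity,
    (mul_le_of_le_one_left' hq1).trans hsr, fun h => ?_⟩
  have h1 := weightedNorm_le_of_dominant hw hR hRn h
  rw [hPR] at h1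
  set D : ℝ≥0 := ‖c‖₊ * (q * s) ^ m with hD
  have hD0 : D ≠ 0 := by positivity
  have hDe : ‖c‖ₑ * ((q * s : ℝ≥0) : ℝ≥0∞) ^ m = D := by
    rw [enorm_eq_nnnorm, hD]; push_cast; ring
  rw [hDe] at h1
  rw [ENNReal.coe_div hD0, ENNReal.coe_ofNat, ← ENNReal.mul_div_right_comm,
    ENNReal.le_div_iff_mul_le (Or.inl (by exact_mod_cast hD0)) (Or.inl ENNReal.coe_ne_top), mul_comm]
  exact h1

/-- Division by powers of a nonzero convergent series: the quotients are estimated geometrically on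
a common polydisk. -/
theorem exists_weightedNorm_le_pow_mul {P : MvPowerSeries (Fin d) ℂ} (hP : P ≠ 0) {ρ : ℝ≥0}
    (hρ : 0 < ρ) (hPρ : weightedNorm 1 ρ (coeffs P) ≠ ⊤) (r : ℝ≥0) (hr : 0 < r) :
    ∃ r' κ : ℝ≥0, 0 < r' ∧ r' ≤ r ∧ ∀ (n : ℕ) (h : FormalSeries d E),
      weightedNorm 1 r' h ≤ κ ^ n * weightedNorm 1 r (seriesSMul (P ^ n) h) := by
  obtain ⟨w, t, κ, hw, ht0, htr, hκ⟩ :=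
    exists_weightedNorm_le_mul (E := E) hP hρ hPρ (min 1 r) (by positivity)
  have ht1 : t ≤ 1 := htr.trans (min_le_left _ _)
  -- The lower bound is iterated at the fixed radius `t`: each factor `P` costs `κ` and no radius is
  -- lost.
  have hpow : ∀ (n : ℕ) (h : FormalSeries d E),
      weightedNorm w t h ≤ κ ^ n * weightedNorm w t (seriesSMul (P ^ n) h) := by
    intro n
    induction n with
    | zero => intro h; simp [one_seriesSMul]
    | succ n ih =>
      intro h
      calc weightedNorm w t h ≤ κ ^ n * weightedNorm w t (seriesSMul (P ^ n) h) := ih h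
        _ ≤ κ ^ n * (κ * weightedNorm w t (seriesSMul P (seriesSMul (P ^ n) h))) := by
            gcongr
            exact hκ _
        _ = κ ^ (n + 1) * weightedNorm w t (seriesSMul (P ^ (n + 1)) h) := by
            rw [← seriesSMul_mul, ← pow_succ', pow_succ (κ : ℝ≥0∞), mul_assoc]
  -- The exponent bounds every `w i`, as the return to degrees requires, and is at least `1`, so
  -- that the new radius is at most `t`.
  refine ⟨t ^ (1 + ∑ i, w i), κ, by positivity, ?_, fun n h => ?_⟩
  · exact ((pow_le_pow_right_of_le_one' ht1 (Nat.le_add_right 1 _)).trans_eq (pow_one t)).trans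
      (htr.trans (min_le_right _ _))
  · refine (weightedNorm_one_pow_le (fun i => ?_) ht1 h).trans ((hpow n h).trans ?_)
    · exact (Finset.single_le_sum (fun i _ => Nat.zero_le (w i)) (Finset.mem_univ i)).trans
        (Nat.le_add_left _ _)
    · gcongr
      exact (weightedNorm_le_weightedNorm_one hw ht1 _).trans
        (weightedNorm_mono (htr.trans (min_le_right _ _)) _)

end Division

/-! ### Holomorphic functions and weighted norms -/

theorem polydisk_eq_ball {r : ℝ} (hr : 0 < r) : polydisk d r = Metric.ball 0 r := by
  ext x
  simp [polydisk, pi_norm_lt_iff hr]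

theorem isOpen_polydisk (d : ℕ) (r : ℝ) : IsOpen (polydisk d r) := by
  simp only [polydisk, Set.ofPred_forall]
  exact isOpen_iInter_of_finite fun i => isOpen_lt (continuous_apply i).norm continuous_const

theorem norm_monomialEval_le {r : ℝ} {x : Fin d → ℂ} (hx : ∀ i, ‖x i‖ ≤ r) (β : Fin d →₀ ℕ) :
    ‖monomialEval x β‖ ≤ r ^ β.degree := by
  rw [monomialEval, norm_prod, Finsupp.degree_eq_sum, ← Finset.prod_pow_eq_pow_sum]
  refine Finset.prod_le_prod (fun i _ => norm_nonneg _) fun i _ => ?_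
  rw [norm_pow]
  exact pow_le_pow_left₀ (norm_nonneg _) (hx i) _

section

variable {E : Type*} [NormedAddCommGroup E]

theorem weightedNorm_one_eq (t : ℝ≥0) (a : FormalSeries d E) :
    weightedNorm 1 t a = ∑' β : Fin d →₀ ℕ, ((‖a β‖₊ * t ^ β.degree : ℝ≥0) : ℝ≥0∞) := by
  simp only [weightedNorm, Finsupp.degree_eq_weight_one, ENNReal.coe_mul, ENNReal.coe_pow,
    enorm_eq_nnnorm]
  rfl

theorem summable_of_weightedNorm_ne_top {t : ℝ≥0} {a : FormalSeries d E}
    (h : weightedNorm 1 t a ≠ ⊤) : Summable fun β : Fin d →₀ ℕ => ‖a β‖ * (t : ℝ) ^ β.degree := by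
  rw [weightedNorm_one_eq, ENNReal.tsum_coe_ne_top_iff_summable] at h
  exact NNReal.summable_coe.2 h

theorem tsum_le_of_weightedNorm_le {t M : ℝ≥0} {a : FormalSeries d E}
    (h : weightedNorm 1 t a ≤ M) : ∑' β : Fin d →₀ ℕ, ‖a β‖ * (t : ℝ) ^ β.degree ≤ M := by
  have hs := ne_top_of_le_ne_top ENNReal.coe_ne_top h
  rw [weightedNorm_one_eq, ENNReal.tsum_coe_ne_top_iff_summable] at hs
  rw [weightedNorm_one_eq, ← ENNReal.coe_tsum hs, ENNReal.coe_le_coe,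
    ← NNReal.coe_le_coe, NNReal.coe_tsum] at h
  exact h

theorem IsConvergent.exists_weightedNorm_ne_top {P : MvPowerSeries (Fin d) ℂ}
    (hP : IsConvergent P) : ∃ ρ : ℝ≥0, 0 < ρ ∧ weightedNorm 1 ρ (coeffs P) ≠ ⊤ := by
  obtain ⟨r, hr, h⟩ := hP
  lift r to ℝ≥0 using hr.le
  refine ⟨r / 2, by exact_mod_cast half_pos hr, ?_⟩
  -- At the diagonal point with entries `r / 2`, summability in `ℂ` is absolute and gives the norm
  -- at radius `r / 2`.
  have hs := (h (fun _ => ((r / 2 : ℝ≥0) : ℂ)) fun i => by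
    simpa [Complex.norm_real] using half_lt_self hr).norm
  rw [weightedNorm_one_eq, ENNReal.tsum_coe_ne_top_iff_summable]
  refine NNReal.summable_coe.1 (hs.congr fun β => ?_)
  rw [norm_mul, monomialEval, Finset.prod_pow_eq_pow_sum, ← Finsupp.degree_eq_sum, norm_pow,
    Complex.norm_real, mul_comm]
  simp [coeffs]

variable [NormedSpace ℂ E]

/-- A formal series of finite weighted norm is the Taylor series of a bounded holomorphic
function. -/
theorem exists_holomorphic_of_weightedNorm_le [CompleteSpace E] {t M : ℝ≥0} (ht : 0 < t)
    {a : FormalSeries d E} (h : weightedNorm 1 t a ≤ M) :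
    ∃ F : (Fin d → ℂ) → E, IsBoundedHolomorphic ((t : ℝ) / 2) F ∧ HasTaylorSeries F a ∧
      ∀ x ∈ polydisk d ((t : ℝ) / 2), ‖F x‖ ≤ M := by
  have ht' : (0 : ℝ) < t := by exact_mod_cast ht
  have ht2 : (0 : ℝ) < t / 2 := half_pos ht'
  have hs := summable_of_weightedNorm_ne_top (ne_top_of_le_ne_top ENNReal.coe_ne_top h)
  have hterm : ∀ x ∈ polydisk d (t : ℝ), ∀ β : Fin d →₀ ℕ,
      ‖monomialEval x β • a β‖ ≤ ‖a β‖ * (t : ℝ) ^ β.degree := by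
    intro x hx β
    rw [norm_smul, mul_comm]
    gcongr
    exact norm_monomialEval_le (fun i => (hx i).le) β
  have hsub : polydisk d ((t : ℝ) / 2) ⊆ polydisk d (t : ℝ) := fun x hx i =>
    (hx i).trans (half_lt_self ht')
  have hsum : ∀ x ∈ polydisk d (t : ℝ), Summable fun β => monomialEval x β • a β :=
    fun x hx => Summable.of_norm_bounded hs (hterm x hx)
  have hd : ∀ β : Fin d →₀ ℕ, Differentiable ℂ fun x : Fin d → ℂ => monomialEval x β • a β := by
    intro β
    unfold monomialEval
    fun_prop
  have hM : ∀ x ∈ polydisk d ((t : ℝ) / 2), ‖∑' β, monomialEval x β • a β‖ ≤ M := by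
    intro x hx
    exact (tsum_of_norm_bounded hs.hasSum (hterm x (hsub hx))).trans (tsum_le_of_weightedNorm_le h)
  refine ⟨fun x => ∑' β, monomialEval x β • a β, ⟨fun x hx => ?_, M, hM⟩, ⟨t, ht', fun x hx =>
    (hsum x hx).hasSum⟩, hM⟩
  -- Halving the radius leaves around each `y` a ball of radius `t / 2` on which the terms are still
  -- controlled; Cauchy's estimate then dominates their derivatives summably.
  have hf' : ∀ (β : Fin d →₀ ℕ), ∀ y ∈ polydisk d ((t : ℝ) / 2),
      ‖fderiv ℂ (fun x : Fin d → ℂ => monomialEval x β • a β) y‖ ≤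
        2 * (‖a β‖ * (t : ℝ) ^ β.degree) / (t / 2) := by
    intro β y hy
    refine Complex.norm_fderiv_le_div_of_mapsTo_ball (hd β).differentiableOn ?_ ht2
    intro z hz
    have hz' : z ∈ polydisk d (t : ℝ) := by
      rw [polydisk_eq_ball ht2, mem_ball_zero_iff] at hy
      rw [polydisk_eq_ball ht', mem_ball_zero_iff]
      rw [mem_ball_iff_norm] at hz
      calc ‖z‖ = ‖(z - y) + y‖ := by rw [sub_add_cancel]
        _ ≤ ‖z - y‖ + ‖y‖ := norm_add_le _ _
        _ < t := by linarith
    rw [mem_closedBall_iff_norm]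
    calc _ ≤ ‖monomialEval z β • a β‖ + ‖monomialEval y β • a β‖ := norm_sub_le _ _
      _ ≤ _ := by linarith [hterm z hz' β, hterm y (hsub hy) β]
  have hpre : IsPreconnected (polydisk d ((t : ℝ) / 2)) := by
    rw [polydisk_eq_ball ht2]
    exact (convex_ball _ _).isPreconnected
  exact (hasFDerivAt_tsum_of_isPreconnected ((hs.mul_left 2).div_const _) (isOpen_polydisk d _)
    hpre (fun β y _ => (hd β y).hasFDerivAt) hf' hx (hsum x (hsub hx))
    hx).differentiableAt.differentiableWithinAt

/-! ### Cauchy estimates and norms of Taylor series. -/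

/-- Cauchy's estimates for the coefficients of a power series on the unit disk. -/
theorem norm_coeff_le_of_hasSum [CompleteSpace E] {g : ℂ → E} {c : ℕ → E} {M : ℝ}
    (hg : DiffContOnCl ℂ g (Metric.ball 0 1)) (hM : ∀ z ∈ Metric.sphere (0 : ℂ) 1, ‖g z‖ ≤ M)
    (hs : ∀ᶠ z in nhds (0 : ℂ), HasSum (fun n => z ^ n • c n) (g z)) (n : ℕ) : ‖c n‖ ≤ M := by
  let p : FormalMultilinearSeries ℂ ℂ E := fun n => ContinuousMultilinearMap.mkPiRing ℂ (Fin n) (c n)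
  have hp : ∀ n, p.coeff n = c n := fun n => by simp [p, FormalMultilinearSeries.coeff]
  have hpg : HasFPowerSeriesAt g p 0 := by
    rw [hasFPowerSeriesAt_iff]
    simpa only [hp, zero_add] using hs
  obtain ⟨r, hr⟩ := hpg
  have h1 := hr.factorial_smul (1 : ℂ) n
  have h2 := Complex.norm_iteratedDeriv_le_of_forall_mem_sphere_norm_le n one_pos hg hM
  have h3 : n.factorial • c n = iteratedDeriv n g 0 := by
    rw [iteratedDeriv_eq_iteratedFDeriv, ← h1, ← hp]
    rfl
  rw [← h3, ← Nat.cast_smul_eq_nsmul ℝ, norm_smul, Real.norm_natCast, one_pow, div_one] at h2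
  exact le_of_mul_le_mul_left h2 (by exact_mod_cast n.factorial_pos)

/-- Cauchy's estimates on a polydisk. -/
theorem norm_coeff_mul_pow_le [CompleteSpace E] {r ρ M : ℝ} (hρ : 0 < ρ) (hρr : ρ < r)
    {F : (Fin d → ℂ) → E} {a : FormalSeries d E} (hF : DifferentiableOn ℂ F (polydisk d r))
    (hM : ∀ x ∈ polydisk d r, ‖F x‖ ≤ M) (ha : HasTaylorSeries F a) (γ : Fin d →₀ ℕ) :
    ‖a γ‖ * ρ ^ γ.degree ≤ M := by
  obtain ⟨w, hw, hsep⟩ := exists_separating_weight d γ.degree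
  obtain ⟨τ, hτ, hsum⟩ := ha
  -- Restricting to this curve reduces to one variable. The monomials of weight `n` are collected in
  -- the coefficient of `z ^ n`, and since `w` separates `γ`, the coefficient at its weight comes
  -- from `γ` alone.
  let φ : ℂ → Fin d → ℂ := fun z i => ρ * z ^ w i
  have hφd : Differentiable ℂ φ := by
    rw [differentiable_pi]
    intro i
    fun_prop
  have hφ : ∀ z β, monomialEval (φ z) β = z ^ Finsupp.weight w β * (ρ : ℂ) ^ β.degree := by
    intro z β
    simp only [monomialEval, φ, mul_pow, Finset.prod_mul_distrib, ← pow_mul]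
    rw [Finset.prod_pow_eq_pow_sum, Finset.prod_pow_eq_pow_sum, Finsupp.weight_eq_sum,
      Finsupp.degree_eq_sum, mul_comm]
    simp only [smul_eq_mul, mul_comm]
  have hφ1 : ∀ z ∈ Metric.closedBall (0 : ℂ) 1, φ z ∈ polydisk d r := by
    intro z hz i
    rw [mem_closedBall_zero_iff] at hz
    simp only [φ, norm_mul, norm_pow, Complex.norm_real, Real.norm_of_nonneg hρ.le]
    exact (mul_le_of_le_one_right hρ.le (pow_le_one₀ (norm_nonneg z) hz)).trans_lt hρr
  have hφ0 : ∀ᶠ z in nhds (0 : ℂ), φ z ∈ polydisk d τ := by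
    refine hφd.continuous.continuousAt.eventually_mem ((isOpen_polydisk d τ).mem_nhds ?_)
    intro i
    simpa [φ, show w i ≠ 0 from by have := hw i; omega] using hτ
  have hg : DiffContOnCl ℂ (F ∘ φ) (Metric.ball 0 1) := by
    refine DifferentiableOn.diffContOnCl ?_
    rw [closure_ball (0 : ℂ) one_ne_zero]
    exact hF.comp hφd.differentiableOn hφ1
  let b : (Fin d →₀ ℕ) → E := fun β => (ρ : ℂ) ^ β.degree • a β
  let c : ℕ → E := fun n => ∑' β : (Finsupp.weight w : (Fin d →₀ ℕ) →+ ℕ) ⁻¹' {n}, b β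
  have hc : ∀ᶠ z in nhds (0 : ℂ), HasSum (fun n => z ^ n • c n) ((F ∘ φ) z) := by
    filter_upwards [hφ0] with z hz
    have h1 := (hsum _ hz).tsum_fiberwise (Finsupp.weight w : (Fin d →₀ ℕ) →+ ℕ)
    convert h1 using 2 with n
    rw [← tsum_const_smul'']
    refine tsum_congr fun β => ?_
    rw [hφ, show Finsupp.weight w β.1 = n from β.2, mul_smul]
    rfl
  have hcγ : c (Finsupp.weight w γ) = b γ := by
    have hfib : ∀ β : (Finsupp.weight w : (Fin d →₀ ℕ) →+ ℕ) ⁻¹' {Finsupp.weight w γ},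
        β = ⟨γ, rfl⟩ := fun β => Subtype.ext ((hsep β.1 γ rfl (le_of_eq β.2)).2 β.2)
    exact tsum_eq_single (⟨γ, rfl⟩ : (Finsupp.weight w : (Fin d →₀ ℕ) →+ ℕ) ⁻¹'
      {Finsupp.weight w γ}) fun β hβ => absurd (hfib β) hβ
  have := norm_coeff_le_of_hasSum hg
    (fun z hz => hM _ (hφ1 z (Metric.sphere_subset_closedBall hz))) hc (Finsupp.weight w γ)
  rw [hcγ, norm_smul, norm_pow, Complex.norm_real, Real.norm_of_nonneg hρ.le, mul_comm] at this
  exact this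

end

/-- The sum is dominated by a product of `d` geometric series. It supplies a constant depending only
on `d`, hence uniform along a sequence of functions. -/
theorem tsum_half_pow_degree_ne_top (d : ℕ) :
    ∑' β : Fin d →₀ ℕ, (2⁻¹ : ℝ≥0∞) ^ β.degree ≠ ⊤ := by
  classical
  refine ne_top_of_le_ne_top (ENNReal.pow_ne_top ENNReal.ofNat_ne_top : (2 : ℝ≥0∞) ^ d ≠ ⊤) ?_
  rw [ENNReal.tsum_eq_iSup_sum]
  refine iSup_le fun s => ?_
  let N := s.sup Finsupp.degree + 1
  calc ∑ β ∈ s, (2⁻¹ : ℝ≥0∞) ^ β.degree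
      = ∑ β ∈ s.map ⟨fun β : Fin d →₀ ℕ => (β : Fin d → ℕ), DFunLike.coe_injective⟩,
          ∏ i, (2⁻¹ : ℝ≥0∞) ^ β i := by
        rw [Finset.sum_map]
        simp only [Finset.prod_pow_eq_pow_sum, Finsupp.degree_eq_sum, Function.Embedding.coeFn_mk]
    _ ≤ ∑ β ∈ Fintype.piFinset fun _ : Fin d => range N, ∏ i, (2⁻¹ : ℝ≥0∞) ^ β i := by
        refine Finset.sum_le_sum_of_subset fun β hβ => ?_
        obtain ⟨β, hβs, rfl⟩ := Finset.mem_map.1 hβ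
        refine Fintype.mem_piFinset.2 fun i => Finset.mem_range.2 (Nat.lt_succ_of_le ?_)
        exact (Finsupp.le_degree i β).trans (Finset.le_sup (f := Finsupp.degree) hβs)
    _ = ∏ _i : Fin d, ∑ j ∈ range N, (2⁻¹ : ℝ≥0∞) ^ j := (Finset.prod_univ_sum _ _).symm
    _ ≤ ∏ _i : Fin d, 2 := by
        refine Finset.prod_le_prod' fun i _ => (ENNReal.sum_le_tsum _).trans ?_
        rw [ENNReal.tsum_geometric, ENNReal.one_sub_inv_two, inv_inv]
    _ = 2 ^ d := by simp

/-- The weighted norm of the Taylor series of a bounded holomorphic function. -/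
theorem exists_weightedNorm_le_of_hasTaylorSeries (d : ℕ) : ∃ K : ℝ≥0,
    ∀ {E : Type*} [NormedAddCommGroup E] [NormedSpace ℂ E] [CompleteSpace E] {r M : ℝ≥0}
      {F : (Fin d → ℂ) → E} {a : FormalSeries d E}, 0 < r →
      DifferentiableOn ℂ F (polydisk d r) → (∀ x ∈ polydisk d r, ‖F x‖ ≤ M) →
      HasTaylorSeries F a → weightedNorm 1 (r / 4) a ≤ (K * M : ℝ≥0) := by
  have hS := tsum_half_pow_degree_ne_top d
  lift ∑' β : Fin d →₀ ℕ, (2⁻¹ : ℝ≥0∞) ^ β.degree to ℝ≥0 using hS with K hK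
  refine ⟨K, ?_⟩
  intro E _ _ _ r M F a hr hF hM ha
  have hr' : (0 : ℝ) < r := by exact_mod_cast hr
  calc weightedNorm 1 (r / 4) a
      ≤ ∑' β : Fin d →₀ ℕ, (M : ℝ≥0∞) * (2⁻¹ : ℝ≥0∞) ^ β.degree := by
        rw [weightedNorm_one_eq]
        refine ENNReal.tsum_le_tsum fun β => ?_
        -- Cauchy's estimate at radius `r / 2`, used for the norm at radius `r / 4`, leaves the
        -- summable factor `2⁻¹ ^ degree`.
        have h1 := norm_coeff_mul_pow_le (half_pos hr') (half_lt_self hr') hF hM ha β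
        have h2 : ‖a β‖₊ * (r / 4) ^ β.degree ≤ M * 2⁻¹ ^ β.degree := by
          have h3 : ‖a β‖₊ * (r / 2) ^ β.degree ≤ M := by exact_mod_cast h1
          calc ‖a β‖₊ * (r / 4) ^ β.degree = ‖a β‖₊ * (r / 2) ^ β.degree * 2⁻¹ ^ β.degree := by
                rw [mul_assoc, ← mul_pow]
                congr 2
                rw [← div_eq_mul_inv, div_div]
                norm_num
            _ ≤ _ := by gcongr
        calc ((‖a β‖₊ * (r / 4) ^ β.degree : ℝ≥0) : ℝ≥0∞)
            ≤ ((M * 2⁻¹ ^ β.degree : ℝ≥0) : ℝ≥0∞) := by exact_mod_cast h2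
          _ = _ := by push_cast; simp
    _ = (K * M : ℝ≥0) := by rw [ENNReal.tsum_mul_left, ← hK, ENNReal.coe_mul, mul_comm]

/-! ### Gevrey growth -/

/-- The growth `(n!) ^ s`. -/
noncomputable def gevreyWeight (s : ℝ) (n : ℕ) : ℝ≥0 := (n.factorial : ℝ≥0) ^ s

section

variable {s : ℝ} (hs : 0 ≤ s)
include hs

theorem gevreyWeight_mono {m n : ℕ} (h : m ≤ n) : gevreyWeight s m ≤ gevreyWeight s n :=
  NNReal.rpow_le_rpow (by exact_mod_cast Nat.factorial_le h) hs

theorem gevreyWeight_mul_le (m n : ℕ) :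
    gevreyWeight s m * gevreyWeight s n ≤ gevreyWeight s (m + n) := by
  rw [gevreyWeight, gevreyWeight, ← NNReal.mul_rpow]
  refine NNReal.rpow_le_rpow ?_ hs
  exact_mod_cast Nat.le_of_dvd (Nat.factorial_pos _) (Nat.factorial_mul_factorial_dvd_factorial_add m n)

/-- The binomial coefficient is at most `2 ^ (m + n)`. The loss is geometric and so can be absorbed
into `A`. -/
theorem gevreyWeight_add_le (m n : ℕ) :
    gevreyWeight s (m + n) ≤ (2 ^ s) ^ (m + n) * (gevreyWeight s m * gevreyWeight s n) := by
  rw [gevreyWeight, gevreyWeight, gevreyWeight, ← NNReal.mul_rpow, ← NNReal.rpow_natCast,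
    ← NNReal.rpow_mul, mul_comm s, NNReal.rpow_mul, ← NNReal.mul_rpow, NNReal.rpow_natCast]
  refine NNReal.rpow_le_rpow ?_ hs
  have h := Nat.mul_le_mul_right (m.factorial * n.factorial) (Nat.choose_le_two_pow (m + n) n)
  rw [← mul_assoc, Nat.add_choose_mul_factorial_mul_factorial] at h
  exact_mod_cast h

theorem gevreyWeight_mul_nat_le (N n : ℕ) :
    gevreyWeight (N * s) n ≤ gevreyWeight s (N * n) := by
  rw [gevreyWeight, gevreyWeight, NNReal.rpow_mul, NNReal.rpow_natCast]
  refine NNReal.rpow_le_rpow ?_ hs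
  have h := Nat.le_of_dvd (Nat.factorial_pos _)
    (Nat.prod_factorial_dvd_factorial_sum (range N) fun _ => n)
  simp only [Finset.prod_const, Finset.sum_const, Finset.card_range, smul_eq_mul] at h
  exact_mod_cast h

theorem exists_gevreyWeight_nat_mul_le (N : ℕ) :
    ∃ D : ℝ≥0, ∀ n, gevreyWeight s (N * n) ≤ D ^ n * gevreyWeight (N * s) n := by
  induction N with
  | zero => exact ⟨1, fun n => by simp [gevreyWeight]⟩
  | succ N ih =>
    obtain ⟨D, hD⟩ := ih
    refine ⟨(2 ^ s) ^ (N + 1) * D, fun n => ?_⟩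
    have hsplit : gevreyWeight ((N + 1 : ℕ) * s) n = gevreyWeight (N * s) n * gevreyWeight s n := by
      rw [gevreyWeight, gevreyWeight, gevreyWeight, Nat.cast_add, Nat.cast_one, add_mul, one_mul,
        NNReal.rpow_add]
      exact_mod_cast Nat.factorial_ne_zero n
    calc gevreyWeight s ((N + 1) * n) = gevreyWeight s (N * n + n) := by rw [add_mul, one_mul]
      _ ≤ (2 ^ s) ^ (N * n + n) * (gevreyWeight s (N * n) * gevreyWeight s n) :=
        gevreyWeight_add_le hs _ _
      _ ≤ (2 ^ s) ^ (N * n + n) * (D ^ n * gevreyWeight (N * s) n * gevreyWeight s n) := by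
        gcongr
        exact hD n
      _ = ((2 ^ s) ^ (N + 1) * D) ^ n * gevreyWeight ((N + 1 : ℕ) * s) n := by
        rw [hsplit, mul_pow, ← pow_mul, add_mul, one_mul]
        ring

end

/-- The terms of the sequence `a` have a common radius at which their norms are `O(A ^ n (n!) ^ s)`
for some `A`. -/
def HasGevreyGrowth {E : Type*} [NormedAddCommGroup E] (s : ℝ) (a : ℕ → FormalSeries d E) : Prop :=
  ∃ ρ C A : ℝ≥0, 0 < ρ ∧
    ∀ n, weightedNorm 1 ρ (a n) ≤ ((C * A ^ n * gevreyWeight s n : ℝ≥0) : ℝ≥0∞)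

/-! ### Operations preserving Gevrey growth. -/

section

variable {E : Type*} [NormedAddCommGroup E] {s : ℝ}

theorem HasGevreyGrowth.exists_common {F : Type*} [NormedAddCommGroup F]
    {a : ℕ → FormalSeries d E} {b : ℕ → FormalSeries d F}
    (ha : HasGevreyGrowth s a) (hb : HasGevreyGrowth s b) :
    ∃ ρ C A : ℝ≥0, 0 < ρ ∧
      (∀ n, weightedNorm 1 ρ (a n) ≤ ((C * A ^ n * gevreyWeight s n : ℝ≥0) : ℝ≥0∞)) ∧
      ∀ n, weightedNorm 1 ρ (b n) ≤ ((C * A ^ n * gevreyWeight s n : ℝ≥0) : ℝ≥0∞) := by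
  obtain ⟨ρ₁, C₁, A₁, hρ₁, h₁⟩ := ha
  obtain ⟨ρ₂, C₂, A₂, hρ₂, h₂⟩ := hb
  refine ⟨min ρ₁ ρ₂, max C₁ C₂, max A₁ A₂, lt_min hρ₁ hρ₂, fun n => ?_, fun n => ?_⟩
  · refine (weightedNorm_mono (min_le_left _ _) _).trans ((h₁ n).trans ?_)
    gcongr <;> exact le_max_left _ _
  · refine (weightedNorm_mono (min_le_right _ _) _).trans ((h₂ n).trans ?_)
    gcongr <;> exact le_max_right _ _

theorem HasGevreyGrowth.add {a b : ℕ → FormalSeries d E} (ha : HasGevreyGrowth s a)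
    (hb : HasGevreyGrowth s b) : HasGevreyGrowth s fun n => a n + b n := by
  obtain ⟨ρ, C, A, hρ, h₁, h₂⟩ := ha.exists_common hb
  refine ⟨ρ, 2 * C, A, hρ, fun n => (weightedNorm_add_le _ _ _ _).trans
    ((add_le_add (h₁ n) (h₂ n)).trans (le_of_eq ?_))⟩
  push_cast
  ring

theorem HasGevreyGrowth.sub {a b : ℕ → FormalSeries d E} (ha : HasGevreyGrowth s a)
    (hb : HasGevreyGrowth s b) : HasGevreyGrowth s fun n => a n - b n := by
  obtain ⟨ρ, C, A, hρ, h₁, h₂⟩ := ha.exists_common hb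
  refine ⟨ρ, 2 * C, A, hρ, fun n => (weightedNorm_sub_le _ _ _ _).trans
    ((add_le_add (h₁ n) (h₂ n)).trans (le_of_eq ?_))⟩
  push_cast
  ring

theorem HasGevreyGrowth.ite {a b : ℕ → FormalSeries d E} (p : ℕ → Prop) [DecidablePred p]
    (ha : HasGevreyGrowth s a) (hb : HasGevreyGrowth s b) :
    HasGevreyGrowth s fun n => if p n then a n else b n := by
  obtain ⟨ρ, C, A, hρ, h₁, h₂⟩ := ha.exists_common hb
  refine ⟨ρ, C, A, hρ, fun n => ?_⟩
  dsimp only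
  split_ifs
  exacts [h₁ n, h₂ n]

theorem HasGevreyGrowth.succ (hs : 0 ≤ s) {a : ℕ → FormalSeries d E} (ha : HasGevreyGrowth s a) :
    HasGevreyGrowth s fun n => a (n + 1) := by
  obtain ⟨ρ, C, A, hρ, h⟩ := ha
  refine ⟨ρ, C * A * 2 ^ s * gevreyWeight s 1, A * 2 ^ s, hρ, fun n => (h (n + 1)).trans ?_⟩
  rw [ENNReal.coe_le_coe]
  calc C * A ^ (n + 1) * gevreyWeight s (n + 1)
      ≤ C * A ^ (n + 1) * ((2 ^ s) ^ (n + 1) * (gevreyWeight s n * gevreyWeight s 1)) := by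
        gcongr
        exact gevreyWeight_add_le hs n 1
    _ = C * A * 2 ^ s * gevreyWeight s 1 * (A * 2 ^ s) ^ n * gevreyWeight s n := by ring

theorem HasGevreyGrowth.comp_mul (hs : 0 ≤ s) (N : ℕ) {a : ℕ → FormalSeries d E}
    (ha : HasGevreyGrowth s a) : HasGevreyGrowth (N * s) fun n => a (N * n) := by
  obtain ⟨ρ, C, A, hρ, h⟩ := ha
  obtain ⟨D, hD⟩ := exists_gevreyWeight_nat_mul_le hs N
  refine ⟨ρ, C, A ^ N * D, hρ, fun n => (h (N * n)).trans ?_⟩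
  rw [ENNReal.coe_le_coe]
  calc C * A ^ (N * n) * gevreyWeight s (N * n)
      ≤ C * A ^ (N * n) * (D ^ n * gevreyWeight (N * s) n) := by
        gcongr
        exact hD n
    _ = C * (A ^ N * D) ^ n * gevreyWeight (N * s) n := by
        rw [mul_pow, ← pow_mul]
        ring

/-- For `N ≥ 1` the index satisfies `n < N * (n / N + 1) ≤ n + N`: large enough for a congruence
modulo `P ^ n`, while the factorial is only that of a bounded shift of `n`. Replacing `A` by `max 1
A` makes its powers monotone in the exponent. -/
theorem HasGevreyGrowth.comp_div (hs : 0 ≤ s) (N : ℕ) {a : ℕ → FormalSeries d E}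
    (ha : HasGevreyGrowth (N * s) a) : HasGevreyGrowth s fun n => a (n / N + 1) := by
  obtain ⟨ρ, C, A, hρ, h⟩ := ha
  refine ⟨ρ, C * max 1 A * (2 ^ s) ^ N * gevreyWeight s N, max 1 A * 2 ^ s, hρ,
    fun n => (h (n / N + 1)).trans ?_⟩
  rw [ENNReal.coe_le_coe]
  calc C * A ^ (n / N + 1) * gevreyWeight (N * s) (n / N + 1)
      ≤ C * max 1 A ^ (n + 1) * gevreyWeight s (n + N) := by
        gcongr C * ?_ * ?_
        · calc A ^ (n / N + 1) ≤ max 1 A ^ (n / N + 1) := by gcongr; exact le_max_right _ _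
            _ ≤ max 1 A ^ (n + 1) := by
              gcongr
              · exact le_max_left _ _
              · exact Nat.div_le_self n N
        · refine (gevreyWeight_mul_nat_le hs N _).trans (gevreyWeight_mono hs ?_)
          rw [mul_add, mul_one]
          gcongr
          exact Nat.mul_div_le n N
    _ ≤ C * max 1 A ^ (n + 1) * ((2 ^ s) ^ (n + N) * (gevreyWeight s n * gevreyWeight s N)) := by
        gcongr
        exact gevreyWeight_add_le hs n N
    _ = _ := by
        rw [mul_pow]
        ring

/-- The factor `β j + 1 ≤ 2 ^ (β.degree + 1)` produced by differentiation is compensated by halving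
the radius. -/
theorem weightedNorm_seriesPDeriv_le (j : Fin d) {t : ℝ≥0} (ht : 0 < t) (a : FormalSeries d E) :
    weightedNorm 1 (t / 2) (seriesPDeriv j a) ≤ ((2 / t : ℝ≥0) : ℝ≥0∞) * weightedNorm 1 t a := by
  rw [weightedNorm_one_eq, weightedNorm_one_eq]
  calc _ ≤ ∑' β : Fin d →₀ ℕ, ((2 / t : ℝ≥0) : ℝ≥0∞) *
          ((‖a (β + Finsupp.single j 1)‖₊ * t ^ (β + Finsupp.single j 1).degree : ℝ≥0) : ℝ≥0∞) := by
        refine ENNReal.tsum_le_tsum fun β => ?_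
        rw [← ENNReal.coe_mul, ENNReal.coe_le_coe]
        have h1 : ‖seriesPDeriv j a β‖₊ ≤ (β j + 1 : ℕ) * ‖a (β + Finsupp.single j 1)‖₊ := by
          have := norm_nsmul_le (n := β j + 1) (a := a (β + Finsupp.single j 1))
          exact_mod_cast this
        have h2 : ((β j + 1 : ℕ) : ℝ≥0) ≤ 2 ^ (β.degree + 1) := by
          have h3 := Finsupp.le_degree j β
          have h4 := (Nat.lt_two_pow_self (n := β.degree + 1)).le
          exact_mod_cast (by omega : β j + 1 ≤ β.degree + 1).trans h4
        have h3 : ‖GevreyGerm.seriesPDeriv j a β‖₊ * (t / 2) ^ β.degree ≤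
            2 / t * (‖a (β + Finsupp.single j 1)‖₊ * t ^ (β + Finsupp.single j 1).degree) := calc
          _ ≤ 2 ^ (β.degree + 1) * ‖a (β + Finsupp.single j 1)‖₊ * (t / 2) ^ β.degree := by
              gcongr
              exact h1.trans (by gcongr)
          _ = 2 / t * (‖a (β + Finsupp.single j 1)‖₊ * t ^ (β + Finsupp.single j 1).degree) := by
              rw [map_add, Finsupp.degree_single, div_pow, pow_succ, pow_succ]
              field_simp
        exact h3
    _ = ((2 / t : ℝ≥0) : ℝ≥0∞) * ∑' β : Fin d →₀ ℕ,
          ((‖a (β + Finsupp.single j 1)‖₊ * t ^ (β + Finsupp.single j 1).degree : ℝ≥0) : ℝ≥0∞) :=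
        ENNReal.tsum_mul_left
    _ ≤ _ := by
        refine mul_le_mul_right ?_ _
        exact ENNReal.tsum_comp_le_tsum_of_injective (add_left_injective (Finsupp.single j 1))
          fun β => ((‖a β‖₊ * t ^ β.degree : ℝ≥0) : ℝ≥0∞)

theorem HasGevreyGrowth.seriesPDeriv (j : Fin d) {a : ℕ → FormalSeries d E}
    (ha : HasGevreyGrowth s a) : HasGevreyGrowth s fun n => seriesPDeriv j (a n) := by
  obtain ⟨ρ, C, A, hρ, h⟩ := ha
  refine ⟨ρ / 2, 2 / ρ * C, A, half_pos hρ, fun n => (weightedNorm_seriesPDeriv_le j hρ _).trans ?_⟩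
  calc ((2 / ρ : ℝ≥0) : ℝ≥0∞) * weightedNorm 1 ρ (a n)
      ≤ ((2 / ρ : ℝ≥0) : ℝ≥0∞) * ((C * A ^ n * gevreyWeight s n : ℝ≥0) : ℝ≥0∞) := by
        gcongr
        exact h n
    _ = _ := by
        rw [← ENNReal.coe_mul]
        congr 1
        ring

/-- Since `m! * n!` is at most `(m + n)!`, each term has the right growth, and the number `n + 1` of
terms is at most `2 ^ n`. -/
theorem HasGevreyGrowth.cauchyProduct (hs : 0 ≤ s) {B : Type*} [NonUnitalNormedRing B]
    {a b : ℕ → FormalSeries d B} (ha : HasGevreyGrowth s a) (hb : HasGevreyGrowth s b) :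
    HasGevreyGrowth s fun n =>
      ∑ p ∈ HasAntidiagonal.antidiagonal n, seriesMul (a p.1) (b p.2) := by
  obtain ⟨ρ, C, A, hρ, h₁, h₂⟩ := ha.exists_common hb
  refine ⟨ρ, C * C, 2 * A, hρ, fun n => (weightedNorm_sum_le _ _ _ _).trans ?_⟩
  calc _ ≤ ∑ _p ∈ HasAntidiagonal.antidiagonal n,
          ((C * C * A ^ n * gevreyWeight s n : ℝ≥0) : ℝ≥0∞) := by
        refine Finset.sum_le_sum fun p hp => (weightedNorm_seriesMul_le _ _ _ _).trans ?_
        refine (mul_le_mul' (h₁ p.1) (h₂ p.2)).trans ?_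
        rw [← ENNReal.coe_mul, ENNReal.coe_le_coe, ← HasAntidiagonal.mem_antidiagonal.1 hp]
        calc C * A ^ p.1 * gevreyWeight s p.1 * (C * A ^ p.2 * gevreyWeight s p.2)
            = C * C * A ^ (p.1 + p.2) * (gevreyWeight s p.1 * gevreyWeight s p.2) := by ring
          _ ≤ _ := by
            gcongr
            exact gevreyWeight_mul_le hs _ _
    _ = (((n + 1 : ℕ) * (C * C * A ^ n * gevreyWeight s n) : ℝ≥0) : ℝ≥0∞) := by
        rw [Finset.sum_const, Finset.Nat.card_antidiagonal, nsmul_eq_mul]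
        push_cast
        rfl
    _ ≤ ((2 ^ n * (C * C * A ^ n * gevreyWeight s n) : ℝ≥0) : ℝ≥0∞) := by
        have : ((n + 1 : ℕ) : ℝ≥0) ≤ 2 ^ n := by exact_mod_cast Nat.lt_two_pow_self (n := n)
        gcongr
    _ = _ := by
        congr 1
        rw [mul_pow]
        ring

variable [NormedSpace ℂ E]

theorem HasGevreyGrowth.partialSum (hs : 0 ≤ s) {P : MvPowerSeries (Fin d) ℂ}
    (hP : IsConvergent P) {a : ℕ → FormalSeries d E} (ha : HasGevreyGrowth s a) :
    HasGevreyGrowth s fun n => ∑ k ∈ range n, seriesSMul (P ^ k) (a k) := by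
  obtain ⟨ρ₁, C, A, hρ₁, h⟩ := ha
  obtain ⟨ρ₂, hρ₂, hp⟩ := hP.exists_weightedNorm_ne_top
  set ρ := min ρ₁ ρ₂
  replace hp : weightedNorm 1 ρ (coeffs P) ≠ ⊤ :=
    ne_top_of_le_ne_top hp (weightedNorm_mono (min_le_right _ _) _)
  have hpow := fun k => weightedNorm_pow_seriesSMul_le 1 ρ P k (a k)
  lift weightedNorm 1 ρ (coeffs P) to ℝ≥0 using hp with p
  refine ⟨ρ, C, 2 * max 1 (p * A), lt_min hρ₁ hρ₂, fun n =>
    (weightedNorm_sum_le _ _ _ _).trans ?_⟩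
  calc _ ≤ ∑ _k ∈ range n, ((C * max 1 (p * A) ^ n * gevreyWeight s n : ℝ≥0) : ℝ≥0∞) := by
        refine Finset.sum_le_sum fun k hk => (hpow k).trans ?_
        have hkn := (Finset.mem_range.1 hk).le
        calc (p : ℝ≥0∞) ^ k * weightedNorm 1 ρ (a k)
            ≤ (p : ℝ≥0∞) ^ k * ((C * A ^ k * gevreyWeight s k : ℝ≥0) : ℝ≥0∞) := by
              gcongr
              exact (weightedNorm_mono (min_le_left _ _) _).trans (h k)
          _ = ((C * (p * A) ^ k * gevreyWeight s k : ℝ≥0) : ℝ≥0∞) := by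
              push_cast
              rw [mul_pow]
              ring
          _ ≤ _ := by
              gcongr ((_ * ?_ * ?_ : ℝ≥0) : ℝ≥0∞)
              · calc (p * A) ^ k ≤ max 1 (p * A) ^ k := by gcongr; exact le_max_right _ _
                  _ ≤ _ := pow_le_pow_right₀ (le_max_left _ _) hkn
              · exact gevreyWeight_mono hs hkn
    _ = ((n * (C * max 1 (p * A) ^ n * gevreyWeight s n) : ℝ≥0) : ℝ≥0∞) := by
        rw [Finset.sum_const, Finset.card_range, nsmul_eq_mul]
        push_cast
        rfl
    _ ≤ ((2 ^ n * (C * max 1 (p * A) ^ n * gevreyWeight s n) : ℝ≥0) : ℝ≥0∞) := by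
        have : (n : ℝ≥0) ≤ 2 ^ n := by exact_mod_cast (Nat.lt_two_pow_self (n := n)).le
        gcongr
    _ = _ := by
        congr 1
        rw [mul_pow]
        ring

/-- Division by the powers of a germ preserves Gevrey growth. -/
theorem HasGevreyGrowth.of_pow_seriesSMul {P : MvPowerSeries (Fin d) ℂ} (hP : IsConvergent P)
    (hP0 : P ≠ 0) {b : ℕ → FormalSeries d E}
    (h : HasGevreyGrowth s fun n => seriesSMul (P ^ n) (b n)) : HasGevreyGrowth s b := by
  obtain ⟨ρ, C, A, hρ, h⟩ := h
  obtain ⟨ρ', hρ', hp⟩ := hP.exists_weightedNorm_ne_top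
  obtain ⟨r, κ, hr, -, hκ⟩ := exists_weightedNorm_le_pow_mul (E := E) hP0 hρ' hp ρ hρ
  refine ⟨r, C, κ * A, hr, fun n => (hκ n (b n)).trans ?_⟩
  calc (κ : ℝ≥0∞) ^ n * weightedNorm 1 ρ (seriesSMul (P ^ n) (b n))
      ≤ (κ : ℝ≥0∞) ^ n * ((C * A ^ n * gevreyWeight s n : ℝ≥0) : ℝ≥0∞) := by
        gcongr
        exact h n
    _ = _ := by
        push_cast
        rw [mul_pow]
        ring

/-- Gevrey bounds for holomorphic functions on a polydisk amount to Gevrey growth of their Taylor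
series. -/
theorem exists_holomorphicSeq_iff [CompleteSpace E] {a : ℕ → FormalSeries d E} :
    (∃ (r C A : ℝ) (F : ℕ → (Fin d → ℂ) → E), 0 < r ∧ 0 < C ∧ 0 < A ∧
      IsHolomorphicSeq r F a ∧ HasGevreyBounds s r C A F) ↔ HasGevreyGrowth s a := by
  constructor
  · rintro ⟨r, C, A, F, hr, hC, hA, hF, hb⟩
    lift r to ℝ≥0 using hr.le
    lift C to ℝ≥0 using hC.le
    lift A to ℝ≥0 using hA.le
    obtain ⟨K, hK⟩ := exists_weightedNorm_le_of_hasTaylorSeries d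
    have hr' : 0 < r := by exact_mod_cast hr
    refine ⟨r / 4, K * C, A, by positivity, fun n => ?_⟩
    rw [mul_assoc, mul_assoc, ← mul_assoc C]
    refine hK hr' (hF.boundedHolomorphic n).holomorphic (fun x hx => ?_) (hF.taylor n)
    refine (hb n x hx).trans_eq ?_
    simp [gevreyWeight]
  · rintro ⟨ρ, C, A, hρ, h⟩
    -- The constants of `HasGevreyGrowth` may be zero; adding `1` makes them positive.
    have h' : ∀ n, weightedNorm 1 ρ (a n) ≤
        (((C + 1) * (A + 1) ^ n * gevreyWeight s n : ℝ≥0) : ℝ≥0∞) := fun n =>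
      (h n).trans (by gcongr <;> exact le_self_add)
    choose F hF hT hM using fun n => exists_holomorphic_of_weightedNorm_le hρ (h' n)
    refine ⟨ρ / 2, C + 1, A + 1, F, half_pos (by exact_mod_cast hρ), by positivity, by positivity,
      ⟨hF, hT⟩, fun n x hx => (hM n x hx).trans_eq ?_⟩
    simp [gevreyWeight]

/-! ### Membership in terms of formal series. -/

theorem mem_gevreySeries_iff [CompleteSpace E] {P : MvPowerSeries (Fin d) ℂ}
    {f : FormalSeries d E} :
    f ∈ GevreySeries P s E ↔
      ∃ a : ℕ → FormalSeries d E, IsAsymptoticFor P f a ∧ HasGevreyGrowth s a := by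
  constructor
  · rintro ⟨r, C, A, F, a, hr, hC, hA, hF, ha, hb⟩
    exact ⟨a, ha, exists_holomorphicSeq_iff.1 ⟨r, C, A, F, hr, hC, hA, hF, hb⟩⟩
  · rintro ⟨a, ha, hg⟩
    obtain ⟨r, C, A, F, hr, hC, hA, hF, hb⟩ := exists_holomorphicSeq_iff.2 hg
    exact ⟨r, C, A, F, a, hr, hC, hA, hF, ha, hb⟩

theorem mem_gevreySeries_iff_expansion [CompleteSpace E] (hs : 0 ≤ s)
    {P : MvPowerSeries (Fin d) ℂ} (hP : IsNonzeroVanishingGerm P) {f : FormalSeries d E} :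
    f ∈ GevreySeries P s E ↔
      ∃ a : ℕ → FormalSeries d E, IsExpansion P f a ∧ HasGevreyGrowth s a := by
  rw [mem_gevreySeries_iff]
  constructor
  · rintro ⟨a, ha, hg⟩
    obtain ⟨b, hb, hexp⟩ := ha.exists_isExpansion
    -- Here the division theorem enters: `P ^ n * b n = a (n + 1) - a n` has Gevrey growth, so `b`
    -- does too, at a common smaller radius.
    have hbg : HasGevreyGrowth s b := by
      refine .of_pow_seriesSMul hP.convergent hP.ne_zero ?_
      simp only [hb]
      exact (hg.succ hs).sub hg
    refine ⟨_, hexp, ?_⟩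
    convert (hg.succ hs).ite (fun n => n = 0) hbg using 2 with n
    split_ifs with hn
    · rw [hn]
    · rfl
  · rintro ⟨a, ha, hg⟩
    exact ⟨_, ha.isAsymptoticFor hP.vanishes, hg.partialSum hs hP.convergent⟩

variable [CompleteSpace E] {P : MvPowerSeries (Fin d) ℂ}

/-! ### Stability properties. -/

theorem add_mem_gevreySeries (hP : IsNonzeroVanishingGerm P) {f g : FormalSeries d E}
    (hf : f ∈ GevreySeries P s E) (hg : g ∈ GevreySeries P s E) :
    f + g ∈ GevreySeries P s E := by
  rw [mem_gevreySeries_iff] at *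
  obtain ⟨a, ha, hag⟩ := hf
  obtain ⟨b, hb, hbg⟩ := hg
  refine ⟨_, .of_congr hP.vanishes fun n => ?_, hag.add hbg⟩
  obtain ⟨h, hh⟩ := ha.congr n
  obtain ⟨k, hk⟩ := hb.congr n
  exact ⟨h + k, by rw [seriesSMul_add, ← hh, ← hk]; abel⟩

theorem seriesPDeriv_mem_gevreySeries (hs : 0 ≤ s) (hP : IsNonzeroVanishingGerm P)
    {f : FormalSeries d E} (hf : f ∈ GevreySeries P s E) (j : Fin d) :
    seriesPDeriv j f ∈ GevreySeries P s E := by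
  rw [mem_gevreySeries_iff] at *
  obtain ⟨a, ha, hag⟩ := hf
  refine ⟨_, .of_congr hP.vanishes fun n => ?_, (hag.succ hs).seriesPDeriv j⟩
  obtain ⟨h, hh⟩ := ha.congr (n + 1)
  obtain ⟨g, hg⟩ := exists_seriesPDeriv_pow_seriesSMul j P n h
  exact ⟨g, by rw [← seriesPDeriv_sub, hh, hg]⟩

/-- Multiplying asymptotic sequences term by term would give bounds with `(n!) ^ (2 * s)`.
Expansions avoid this, because their Cauchy product pairs indices of total `n`. -/
theorem seriesMul_mem_gevreySeries {B : Type*} [NonUnitalNormedRing B] [NormedSpace ℂ B]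
    [IsScalarTower ℂ B B] [SMulCommClass ℂ B B] [CompleteSpace B] (hs : 0 ≤ s)
    (hP : IsNonzeroVanishingGerm P) {f g : FormalSeries d B}
    (hf : f ∈ GevreySeries P s B) (hg : g ∈ GevreySeries P s B) :
    seriesMul f g ∈ GevreySeries P s B := by
  rw [mem_gevreySeries_iff_expansion hs hP] at *
  obtain ⟨a, ha, hag⟩ := hf
  obtain ⟨b, hb, hbg⟩ := hg
  exact ⟨_, ha.seriesMul hP.vanishes hb, hag.cauchyProduct hs hbg⟩

theorem gevreySeries_pow (hs : 0 ≤ s) (hP : IsNonzeroVanishingGerm P) {N : ℕ} (hN : 1 ≤ N) :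
    GevreySeries (P ^ N) (N * s) E = GevreySeries P s E := by
  have hPN : MvPowerSeries.constantCoeff (P ^ N) = 0 := by
    rw [map_pow, hP.vanishes, zero_pow (by omega)]
  ext f
  rw [mem_gevreySeries_iff, mem_gevreySeries_iff]
  constructor
  · rintro ⟨a, ha, hag⟩
    refine ⟨_, .of_congr hP.vanishes fun n => ?_, hag.comp_div hs N⟩
    obtain ⟨h, hh⟩ := ha.congr (n / N + 1)
    -- The truncated subtraction is exact because `n < N * (n / N + 1)`; the surplus powers of `P`
    -- go into the cofactor.
    have hn : n + (N * (n / N + 1) - n) = N * (n / N + 1) := by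
      have h1 := Nat.lt_mul_div_succ n hN
      omega
    refine ⟨seriesSMul (P ^ (N * (n / N + 1) - n)) h, ?_⟩
    rw [hh, ← seriesSMul_mul, ← pow_add, hn, pow_mul]
  · rintro ⟨a, ha, hag⟩
    refine ⟨_, .of_congr hPN fun n => ?_, hag.comp_mul hs N⟩
    obtain ⟨h, hh⟩ := ha.congr (N * n)
    exact ⟨h, by rw [hh, pow_mul]⟩

/-- The same sequence works, since `P ^ n * h = Q ^ n * (R ^ n * h)`. -/
theorem gevreySeries_subset_of_germDvd {Q : MvPowerSeries (Fin d) ℂ}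
    (hQ : IsNonzeroVanishingGerm Q) (hQP : GermDvd Q P) :
    GevreySeries P s E ⊆ GevreySeries Q s E := by
  intro f hf
  rw [mem_gevreySeries_iff] at *
  obtain ⟨a, ha, hag⟩ := hf
  obtain ⟨R, -, rfl⟩ := hQP
  refine ⟨a, .of_congr hQ.vanishes fun n => ?_, hag⟩
  obtain ⟨h, hh⟩ := ha.congr n
  exact ⟨seriesSMul (R ^ n) h, by rw [hh, mul_pow, seriesSMul_mul]⟩

end

end GevreyGerm

theorem mainTheorem6 {d : ℕ} {E : Type*} [NormedAddCommGroup E] [NormedSpace ℂ E]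
    [CompleteSpace E] (s : ℝ) (hs : 0 ≤ s) (P : MvPowerSeries (Fin d) ℂ)
    (hP : GevreyGerm.IsNonzeroVanishingGerm P) :
    -- characterization of `P`-`s`-Gevrey series
    (∀ f : GevreyGerm.FormalSeries d E,
      f ∈ GevreyGerm.GevreySeries P s E ↔
        ∃ (r C A : ℝ) (F : ℕ → (Fin d → ℂ) → E) (a : ℕ → GevreyGerm.FormalSeries d E),
          0 < r ∧ 0 < C ∧ 0 < A ∧ GevreyGerm.IsHolomorphicSeq r F a ∧
            GevreyGerm.IsExpansion P f a ∧ GevreyGerm.HasGevreyBounds s r C A F) ∧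
    -- stability under sums
    (∀ f ∈ GevreyGerm.GevreySeries P s E, ∀ g ∈ GevreyGerm.GevreySeries P s E,
      f + g ∈ GevreyGerm.GevreySeries P s E) ∧
    -- stability under partial derivatives
    (∀ f ∈ GevreyGerm.GevreySeries P s E, ∀ j : Fin d,
      GevreyGerm.seriesPDeriv j f ∈ GevreyGerm.GevreySeries P s E) ∧
    -- stability under products, for coefficients in a complex Banach algebra
    (∀ (B : Type*) [NonUnitalNormedRing B] [NormedSpace ℂ B] [IsScalarTower ℂ B B]
      [SMulCommClass ℂ B B] [CompleteSpace B],
      ∀ f ∈ GevreyGerm.GevreySeries P s B, ∀ g ∈ GevreyGerm.GevreySeries P s B,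
        GevreyGerm.seriesMul f g ∈ GevreyGerm.GevreySeries P s B) ∧
    -- powers of the germ
    (∀ N : ℕ, 1 ≤ N →
      GevreyGerm.GevreySeries (P ^ N) ((N : ℝ) * s) E = GevreyGerm.GevreySeries P s E) ∧
    -- divisors of the germ
    (∀ Q : MvPowerSeries (Fin d) ℂ, GevreyGerm.IsNonzeroVanishingGerm Q →
      GevreyGerm.GermDvd Q P →
        GevreyGerm.GevreySeries P s E ⊆ GevreyGerm.GevreySeries Q s E) := by
  refine ⟨fun f => ?_, fun f hf g hg => GevreyGerm.add_mem_gevreySeries hP hf hg,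
    fun f hf j => GevreyGerm.seriesPDeriv_mem_gevreySeries hs hP hf j, ?_,
    fun N hN => GevreyGerm.gevreySeries_pow hs hP hN,
    fun Q hQ hQP => GevreyGerm.gevreySeries_subset_of_germDvd hQ hQP⟩
  · rw [GevreyGerm.mem_gevreySeries_iff_expansion hs hP]
    constructor
    · rintro ⟨a, ha, hg⟩
      obtain ⟨r, C, A, F, hr, hC, hA, hF, hb⟩ := GevreyGerm.exists_holomorphicSeq_iff.2 hg
      exact ⟨r, C, A, F, a, hr, hC, hA, hF, ha, hb⟩
    · rintro ⟨r, C, A, F, a, hr, hC, hA, hF, ha, hb⟩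
      exact ⟨a, ha, GevreyGerm.exists_holomorphicSeq_iff.1 ⟨r, C, A, F, hr, hC, hA, hF, hb⟩⟩
  · intro B _ _ _ _ _ f hf g hg
    exact GevreyGerm.seriesMul_mem_gevreySeries hs hP hf hg
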